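/- Let $g \ge 1$. For a principally polarized complex abelian variety $(V,L)$ of dimension $g$, let $d_{KE}(V)$ be the distance on $V$ induced by the flat Kähler metric with Kähler class $c_1(L)$, and let $\mathrm{diam}(V)$ be the diameter of $(V, d_{KE}(V))$. Let $A_g = \mathrm{Sp}_{2g}(\mathbb{Z})\backslash \mathfrak{H}_g$ be the moduli space of such varieties and let $\overline{A_g} = A_g \sqcup A_{g-1} \sqcup \dots \sqcup A_0$ be its Satake–Baily–Borel compactification, whose stratum $A_0$ is a single point (the deepest cusp). (i) Let $(V_i)_{i}$ be any sequence of $g$-dimensional principally polarized complex abelian varieties whose classes in $A_g$ converge to the point $A_0$ in $\overline{A_g}$. Then there are an integer $r$ with $0 \le r < g$, a flat real torus $T$ of dimension $g-r$ and diameter $1$ (a quotient of Euclidean space $\mathbb{R}^{g-r}$ by a lattice of full rank, with the induced distance), and a subsequence of $\bigl(V_i, d_{KE}(V_i)/\mathrm{diam}(V_i)\bigr)$ that converges to $T$ in the Gromov–Hausdorff sense. (ii) Conversely, for every integer $r$ with $0 \le r < g$ and every flat real torus $T$ of dimension $g-r$ and diameter $1$, there is a sequence $(V_i)_i$ of $g$-dimensional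 principally polarized complex abelian varieties whose classes in $A_g$ converge to the point $A_0$ in $\overline{A_g}$, such that $\bigl(V_i, d_{KE}(V_i)/\mathrm{diam}(V_i)\bigr)$ converges to $T$ in the Gromov–Hausdorff sense. -/

import Mathlib

open Filter Topology

noncomputable section

/-! ### Flat tori and the Gromov–Hausdorff space -/

/-- A discrete subgroup is closed, so the quotient carries Mathlib's quotient norm
`‖x + L‖ = inf {‖x + l‖ : l ∈ L}`; the distance `‖p - q‖` of the quotient is the flat
(geodesic) distance of the torus `E ⧸ L`. -/
instance isClosed_of_discrete_lattice {E : Type*} [NormedAddCommGroup E]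
    (L : Submodule ℤ E) [DiscreteTopology L] : IsClosed (L : Set E) :=
  @AddSubgroup.isClosed_of_discrete _ _ _ _ _ L.toAddSubgroup ‹_›

/-- The quotient of a finite-dimensional space by a lattice is compact. -/
instance compactSpace_quotient_lattice {E : Type*} [NormedAddCommGroup E] [NormedSpace ℝ E]
    [FiniteDimensional ℝ E] (L : Submodule ℤ E) [DiscreteTopology L] [IsZLattice ℝ L] :
    CompactSpace (E ⧸ L) := by
  have := FiniteDimensional.proper_real E
  have : Module.Free ℤ L := ZLattice.module_free ℝ L
  have : Module.Finite ℤ L := ZLattice.module_finite ℝ L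
  let b := Module.Free.chooseBasis ℤ L
  let c := b.ofZLatticeBasis ℝ L
  have hc : Submodule.span ℤ (Set.range c) = L := b.ofZLatticeBasis_span ℝ
  obtain ⟨R, hR⟩ := (ZSpan.fundamentalDomain_isBounded c).subset_closedBall 0
  have hK : IsCompact ((L.mkQ : E → E ⧸ L) '' Metric.closedBall 0 R) :=
    (isCompact_closedBall (0 : E) R).image continuous_quot_mk
  refine ⟨?_⟩
  convert hK
  refine (Set.eq_univ_of_forall fun q => ?_).symm
  obtain ⟨x, rfl⟩ := L.mkQ_surjective q
  refine ⟨ZSpan.fract c x, hR (ZSpan.fract_mem_fundamentalDomain c x), ?_⟩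
  have hx : (ZSpan.floor c x : E) ∈ L := by
    exact hc.le (ZSpan.floor c x).2
  have h0 : L.mkQ (ZSpan.floor c x : E) = 0 := (Submodule.Quotient.mk_eq_zero L).2 hx
  rw [ZSpan.fract_apply, map_sub, h0, sub_zero]

/-- The space `X` with its distance multiplied by the positive constant `c`. -/
def Rescaled (X : Type*) (_c : {c : ℝ // 0 < c}) : Type _ := X

namespace Rescaled

variable (X : Type*) [MetricSpace X] (c : {c : ℝ // 0 < c})

instance : MetricSpace (Rescaled X c) where
  dist x y := c.1 * dist (α := X) x y
  dist_self x := mul_eq_zero_of_right c.1 (dist_self (α := X) x)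
  dist_comm x y := congrArg (c.1 * ·) (dist_comm (α := X) x y)
  dist_triangle x y z :=
    (mul_le_mul_of_nonneg_left (dist_triangle (α := X) x y z) c.2.le).trans_eq
      (mul_add c.1 _ _)
  eq_of_dist_eq_zero {x y} h := by
    change c.1 * dist (α := X) x y = 0 at h
    exact eq_of_dist_eq_zero (γ := X) ((mul_eq_zero.1 h).resolve_left c.2.ne')

theorem dist_def (x y : X) :
    dist (α := Rescaled X c) x y = c.1 * dist (α := X) x y := rfl

instance [Nonempty X] : Nonempty (Rescaled X c) := ‹Nonempty X›

instance [CompactSpace X] : CompactSpace (Rescaled X c) := by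
  have h : LipschitzWith (α := X) (β := Rescaled X c) ⟨c.1, c.2.le⟩ (fun x => x : X → Rescaled X c) :=
    LipschitzWith.of_dist_le_mul (α := X) (β := Rescaled X c) fun x y => le_of_eq (dist_def X c x y)
  have hr := isCompact_range (X := X) (Y := Rescaled X c) h.continuous
  refine ⟨?_⟩
  convert hr
  exact (Set.range_eq_univ.2 (show Function.Surjective (fun x => x : X → Rescaled X c) from
    fun x => ⟨x, rfl⟩)).symm

end Rescaled

/-- The factor `1 / diam X` (with the value `1` for a space of diameter `0`). -/
def unitScale (X : Type*) [MetricSpace X] : {c : ℝ // 0 < c} :=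
  if h : 0 < Metric.diam (Set.univ : Set X) then
    ⟨(Metric.diam (Set.univ : Set X))⁻¹, inv_pos.2 h⟩
  else ⟨1, one_pos⟩

/-- The point of the Gromov–Hausdorff space given by `(X, d / diam d)`. -/
def normalizedGH (X : Type) [MetricSpace X] [CompactSpace X] [Nonempty X] :
    GromovHausdorff.GHSpace :=
  GromovHausdorff.toGHSpace (Rescaled X (unitScale X))

/-- A flat torus of real dimension `n`: a quotient of Euclidean space `ℝⁿ` by a full lattice. -/
structure FlatTorus (n : ℕ) where
  lattice : Submodule ℤ (EuclideanSpace ℝ (Fin n))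
  [discrete : DiscreteTopology lattice]
  [isZLattice : IsZLattice ℝ lattice]

namespace FlatTorus

attribute [instance] FlatTorus.discrete FlatTorus.isZLattice

variable {n : ℕ} (T : FlatTorus n)

/-- The underlying metric space `ℝⁿ ⧸ L`. -/
abbrev Space : Type := EuclideanSpace ℝ (Fin n) ⧸ T.lattice

/-- The diameter of the flat torus. -/
def diam : ℝ := Metric.diam (Set.univ : Set T.Space)

/-- The isometry class of the flat torus. -/
def toGH : GromovHausdorff.GHSpace := GromovHausdorff.toGHSpace T.Space

end FlatTorus

/-! ### Principally polarized complex abelian varieties -/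

/-- A principally polarized complex abelian variety of dimension `g`, given by Riemann's
conditions: a complex torus `carrier ⧸ lattice` together with a positive definite Hermitian form
`H` on the `g`-dimensional complex space `carrier` (here the inner product, `H x y = ⟪y, x⟫`)
whose imaginary part `E = Im H` is integer-valued and unimodular on the lattice. The form `E` is
the first Chern class of the polarization `L`. -/
structure PPAV (g : ℕ) where
  carrier : Type
  [normed : NormedAddCommGroup carrier]
  [innerProduct : InnerProductSpace ℂ carrier]
  [finiteDimensional : FiniteDimensional ℂ carrier]
  finrank_eq : Module.finrank ℂ carrier = g
  lattice : Submodule ℤ carrier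
  [discrete : DiscreteTopology lattice]
  [isZLattice : IsZLattice ℝ lattice]
  integral : ∀ x ∈ lattice, ∀ y ∈ lattice, ∃ m : ℤ, (inner ℂ y x).im = m
  unimodular : ∀ φ : lattice →ₗ[ℤ] ℤ, ∃ x ∈ lattice, ∀ y : lattice,
    (inner ℂ (y : carrier) x).im = φ y

namespace PPAV

attribute [instance] PPAV.normed PPAV.innerProduct PPAV.finiteDimensional PPAV.discrete
  PPAV.isZLattice

variable {g : ℕ} (V : PPAV g)

/-- The alternating form `E = Im H`. -/
def form (x y : V.carrier) : ℝ := (inner ℂ y x).im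

/-- The complex torus with the distance `d_KE` of the flat Kähler metric `Re H`, the
translation-invariant metric whose Kähler class is `c₁(L)`. -/
abbrev Space : Type := V.carrier ⧸ V.lattice

/-- The isometry class of `(V, d_KE / diam d_KE)`. -/
def toNormalizedGH : GromovHausdorff.GHSpace := normalizedGH V.Space

end PPAV

/-! ### Siegel upper half spaces and the moduli space -/

/-- The Siegel upper half space `ℍ_k`: complex symmetric matrices with positive definite
imaginary part. -/
def SiegelSpace (k : ℕ) : Type :=
  {Z : Matrix (Fin k) (Fin k) ℂ // Z.IsSymm ∧ (Z.map Complex.im).PosDef}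

instance (k : ℕ) : TopologicalSpace (SiegelSpace k) :=
  inferInstanceAs (TopologicalSpace
    {Z : Matrix (Fin k) (Fin k) ℂ // Z.IsSymm ∧ (Z.map Complex.im).PosDef})

/-- `W = (A Z + B) (C Z + D)⁻¹` for some `(A B; C D)` in `Sp(2k, ℤ)`, written without the inverse
(the matrix `C Z + D` is always invertible). -/
def SiegelSpace.Rel {k : ℕ} (Z W : SiegelSpace k) : Prop :=
  ∃ M ∈ Matrix.symplecticGroup (Fin k) ℤ,
    W.1 * (M.toBlocks₂₁.map (Int.cast : ℤ → ℂ) * Z.1 + M.toBlocks₂₂.map (Int.cast : ℤ → ℂ)) =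
      M.toBlocks₁₁.map (Int.cast : ℤ → ℂ) * Z.1 + M.toBlocks₁₂.map (Int.cast : ℤ → ℂ)

/-- The moduli space `A_k = Sp(2k, ℤ) \ ℍ_k`, as a set. -/
def SiegelModuli (k : ℕ) : Type := Quot (SiegelSpace.Rel (k := k))

/-- `Z` is a period matrix of `V`: the lattice has a symplectic basis `a₁, …, a_g, b₁, …, b_g` with
`E(aᵢ, bⱼ) = δᵢⱼ` and `aᵢ = ∑ⱼ Zᵢⱼ bⱼ`. Equivalently, the point of the moduli space `A_g`
corresponding to `V` is the class of `Z`. -/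
def PPAV.IsPeriodMatrix {g : ℕ} (V : PPAV g) (Z : SiegelSpace g) : Prop :=
  ∃ a b : Fin g → V.carrier,
    Submodule.span ℤ (Set.range a ∪ Set.range b) = V.lattice ∧
    (∀ i j, V.form (a i) (a j) = 0) ∧ (∀ i j, V.form (b i) (b j) = 0) ∧
    (∀ i j, V.form (a i) (b j) = if i = j then 1 else 0) ∧
    ∀ i, a i = ∑ j, Z.1 i j • b j

/-! ### The Satake–Baily–Borel compactification -/

namespace SiegelSpace

/-- The upper left `k × k` block of a point of `ℍ_{k+n}`, a point of `ℍ_k`. -/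
def topLeft {k n : ℕ} (Z : SiegelSpace (k + n)) : SiegelSpace k :=
  ⟨Z.1.submatrix (Fin.castAdd n) (Fin.castAdd n),
    Z.2.1.submatrix _,
    Z.2.2.submatrix (Fin.castAdd_injective k n)⟩

/-- For `Im Z = (Y₁ Y₁₂; ᵗY₁₂ Y₂)` with blocks of sizes `k` and `n`, the `n × n` matrix
`Y₂ - ᵗY₁₂ Y₁⁻¹ Y₁₂`. -/
def schur {k n : ℕ} (Z : SiegelSpace (k + n)) : Matrix (Fin n) (Fin n) ℝ :=
  let Y := Z.1.map Complex.im
  Y.submatrix (Fin.natAdd k) (Fin.natAdd k) -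
    Y.submatrix (Fin.natAdd k) (Fin.castAdd n) *
      (Y.submatrix (Fin.castAdd n) (Fin.castAdd n))⁻¹ *
      Y.submatrix (Fin.castAdd n) (Fin.natAdd k)

end SiegelSpace

/-- The Satake–Baily–Borel compactification of `A_g`: the disjoint union
`A_g ⊔ A_{g-1} ⊔ ⋯ ⊔ A_0`, topologized below. -/
structure SatakeBB (g : ℕ) where
  /-- the index `k` of the stratum `A_k` -/
  stratum : ℕ
  le : stratum ≤ g
  point : SiegelModuli stratum

namespace SatakeBB

variable {g : ℕ}

/-- The class of a point of `ℍ_k`. -/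
def ofSiegel (k : ℕ) (hk : k ≤ g) (Z : SiegelSpace k) : SatakeBB g := ⟨k, hk, Quot.mk _ Z⟩

/-- The Satake topology, in its description by cylindrical neighbourhoods: the sets
`{Z ∈ ℍ_{k+n} | topLeft Z ∈ U, schur Z > c}`, for `0 ≤ n ≤ g - k`, together represent a
neighbourhood of the class of `Z₀ ∈ ℍ_k`, where `U` is a neighbourhood of `Z₀` in `ℍ_k` and `c > 0`;
these generate the neighbourhoods. For `n = 0` the second condition is empty. -/
instance : TopologicalSpace (SatakeBB g) where
  IsOpen W := ∀ (k : ℕ) (hk : k ≤ g) (Z₀ : SiegelSpace k), ofSiegel k hk Z₀ ∈ W →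
    ∃ U ∈ 𝓝 Z₀, ∃ c : ℝ, 0 < c ∧ ∀ (n : ℕ) (hn : k + n ≤ g) (Z : SiegelSpace (k + n)),
      Z.topLeft ∈ U → (Z.schur - c • (1 : Matrix (Fin n) (Fin n) ℝ)).PosDef →
        ofSiegel (k + n) hn Z ∈ W
  isOpen_univ := fun _ _ _ _ => ⟨Set.univ, univ_mem, 1, one_pos, fun _ _ _ _ _ => trivial⟩
  isOpen_inter := by
    intro W₁ W₂ h₁ h₂ k hk Z₀ hZ
    obtain ⟨U₁, hU₁, c₁, hc₁, H₁⟩ := h₁ k hk Z₀ hZ.1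
    obtain ⟨U₂, hU₂, c₂, hc₂, H₂⟩ := h₂ k hk Z₀ hZ.2
    have key : ∀ {n : ℕ} (S : Matrix (Fin n) (Fin n) ℝ) (c c' : ℝ), c' ≤ c →
        (S - c • (1 : Matrix (Fin n) (Fin n) ℝ)).PosDef →
        (S - c' • (1 : Matrix (Fin n) (Fin n) ℝ)).PosDef := by
      intro n S c c' hcc hS
      have h : ((c - c') • (1 : Matrix (Fin n) (Fin n) ℝ)).PosSemidef :=
        Matrix.PosSemidef.one.smul (sub_nonneg.2 hcc)
      have := hS.add_posSemidef h
      rwa [sub_smul, sub_add_sub_cancel] at this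
    refine ⟨U₁ ∩ U₂, inter_mem hU₁ hU₂, max c₁ c₂, lt_max_of_lt_left hc₁, ?_⟩
    intro n hn Z hZU hZc
    exact ⟨H₁ n hn Z hZU.1 (key _ _ _ (le_max_left _ _) hZc),
      H₂ n hn Z hZU.2 (key _ _ _ (le_max_right _ _) hZc)⟩
  isOpen_sUnion := by
    intro S hS k hk Z₀ hZ
    obtain ⟨W, hW, hZW⟩ := hZ
    obtain ⟨U, hU, c, hc, H⟩ := hS W hW k hk Z₀ hZW
    exact ⟨U, hU, c, hc, fun n hn Z h₁ h₂ => ⟨W, hW, H n hn Z h₁ h₂⟩⟩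

/-- The unique point of the zero-dimensional stratum `A_0`. -/
def cusp (g : ℕ) : SatakeBB g :=
  ofSiegel 0 (Nat.zero_le g)
    ⟨0, Matrix.isSymm_zero, by
      rw [Subsingleton.elim (Matrix.map (0 : Matrix (Fin 0) (Fin 0) ℂ) Complex.im) 1]
      exact Matrix.PosDef.one⟩

end SatakeBB

/-- The moduli points in `A_g` of a sequence of principally polarized abelian varieties converge
to the cusp `A_0` in the Satake–Baily–Borel compactification. -/
def ConvergesToCusp {g : ℕ} (V : ℕ → PPAV g) : Prop :=
  ∃ Z : ℕ → SiegelSpace g, (∀ i, (V i).IsPeriodMatrix (Z i)) ∧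
    Tendsto (fun i => SatakeBB.ofSiegel g le_rfl (Z i)) atTop (𝓝 (SatakeBB.cusp g))

end

/-! ### Gromov–Hausdorff convergence of quotients -/

/-! Part (i) rests on one fact: near the deepest cusp the lattice of `V` contains `g` independent,
arbitrarily short vectors. No reduction theory is needed for it. `SiegelSpace.HasShortVectors ε`
asks a point of `ℍ_k` for `k` independent integral vectors of squared norm below `ε`. It is
invariant under the symplectic group and vacuous for `k = 0`. It also defines an open set of the
Satake space: if the Schur complement is large, short vectors of the upper left block lift to short
vectors, and the new coordinate directions supply the missing ones (`HasShortVectors.of_topLeft`,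
`isOpen_shortVectorSet`).

Integrality of the polarization turns a short vector into a lower bound for the diameter
(`inv_two_mul_norm_le_diam`), so the vectors stay short after normalization. The normalized lattices
in `ℝ^{2g}` are uniformly cocompact, hence their distance functions subconverge to that of a closed
subgroup `Γ`. The short vectors force the largest subspace `K` of `Γ` to have dimension at least
`g`. The limit is `Kᗮ / (Γ ∩ Kᗮ)`, a flat torus of dimension at most `g`, and of positive dimension
because its diameter is `1`.

For (ii), let the rows of `B₀` be a basis of the lattice of `T`, with `d = g - r`. Take period
matrices `i B Bᵀ` with `B = diag(s² B₀, s · 1)` and `s → ∞`. The lattice consists of the rows of `B`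
in the real directions and the columns of `B⁻¹` in the imaginary ones. On the scale `s²` the first
`d` real directions reproduce `T`, while the other real directions (size `s`) and all imaginary ones
collapse. Since `Im Z = B Bᵀ` exceeds every multiple of the identity, the moduli points tend to the
cusp. -/

/-- Lipschitz parametrizations of `X i` and `Y` by a fixed totally bounded set, for which the
distances converge pointwise, give Gromov–Hausdorff convergence. -/
theorem tendsto_toGHSpace_of_tendsto_dist {E : Type*} [PseudoMetricSpace E] {S : Set E}
    (hS : TotallyBounded S) {X : ℕ → Type} [∀ i, MetricSpace (X i)] [∀ i, CompactSpace (X i)]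
    [∀ i, Nonempty (X i)] {Y : Type} [MetricSpace Y] [CompactSpace Y] [Nonempty Y]
    (p : ∀ i, E → X i) (q : E → Y) (K : NNReal) (hp : ∀ᶠ i in atTop, LipschitzWith K (p i))
    (hpS : ∀ᶠ i in atTop, ∀ x, ∃ e ∈ S, p i e = x) (hqS : ∀ y, ∃ e ∈ S, q e = y)
    (hlim : ∀ x y, Tendsto (fun i => dist (p i x) (p i y)) atTop (𝓝 (dist (q x) (q y)))) :
    Tendsto (fun i => GromovHausdorff.toGHSpace (X i)) atTop
      (𝓝 (GromovHausdorff.toGHSpace Y)) := by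
  have hq : LipschitzWith K q := LipschitzWith.of_dist_le_mul fun x y =>
    le_of_tendsto (hlim x y) (hp.mono fun i hi => hi.dist_le_mul x y)
  rw [Metric.tendsto_nhds]
  intro δ hδ
  -- The three terms are the net error in `X i`, half the distortion, and the net error in `Y` of
  -- `ghDist_le_of_approx_subsets`.
  obtain ⟨ε, hε, hεδ⟩ : ∃ ε : ℝ, 0 < ε ∧ K * ε + ε / 2 + (K * ε + ε) < δ := by
    have hK : (0 : ℝ) ≤ K := K.2
    refine ⟨δ / (2 * K + 2), by positivity, ?_⟩
    have : K * (δ / (2 * K + 2)) + δ / (2 * K + 2) / 2 + (K * (δ / (2 * K + 2)) + δ / (2 * K + 2))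
        = δ * ((2 * K + 3 / 2) / (2 * K + 2)) := by ring
    rw [this]
    refine mul_lt_of_lt_one_right hδ ?_
    rw [div_lt_one (by positivity)]
    linarith
  obtain ⟨t, ht, htS⟩ := Metric.totallyBounded_iff.1 hS ε hε
  have hnet : ∀ e ∈ S, ∃ u ∈ t, dist e u ≤ ε := fun e he => by
    obtain ⟨u, hu, h⟩ := Set.mem_iUnion₂.1 (htS he)
    exact ⟨u, hu, (Metric.mem_ball.1 h).le⟩
  have hclose : ∀ᶠ i in atTop, ∀ u ∈ t, ∀ v ∈ t,
      |dist (p i u) (p i v) - dist (q u) (q v)| ≤ ε := by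
    rw [ht.eventually_all]
    intro u _
    rw [ht.eventually_all]
    intro v _
    filter_upwards [Metric.tendsto_nhds.1 (hlim u v) ε hε] with i hi
    exact hi.le
  filter_upwards [hclose, hp, hpS] with i hc hL hs
  -- `p i` need not be injective, so each point of the net in `X i` gets one chosen parameter in
  -- `t`.
  choose ψ hψt hψ using fun x : p i '' t => x.2
  refine lt_of_le_of_lt (GromovHausdorff.ghDist_le_of_approx_subsets (s := p i '' t)
    (fun x => q (ψ x)) (fun x => ?_) (fun y => ?_) fun x y => ?_) hεδ
  · obtain ⟨e, he, rfl⟩ := hs x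
    obtain ⟨u, hu, hue⟩ := hnet e he
    exact ⟨p i u, ⟨u, hu, rfl⟩, (hL.dist_le_mul e u).trans
      (mul_le_mul_of_nonneg_left hue K.2)⟩
  · obtain ⟨e, he, rfl⟩ := hqS y
    obtain ⟨u, hu, hue⟩ := hnet e he
    refine ⟨⟨p i u, u, hu, rfl⟩, ?_⟩
    -- The chosen parameter `w` may differ from `u`, but both have the same image in `X i`, so `hc`
    -- puts `q u` and `q w` within `ε`.
    set w := ψ ⟨p i u, u, hu, rfl⟩ with hw
    have h1 := hc u hu w (hψt _)
    rw [hw, hψ, ← hw, dist_self, zero_sub, abs_neg, abs_of_nonneg dist_nonneg] at h1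
    calc dist (q e) (q w) ≤ dist (q e) (q u) + dist (q u) (q w) := dist_triangle _ _ _
      _ ≤ K * ε + ε := add_le_add ((hq.dist_le_mul e u).trans
          (mul_le_mul_of_nonneg_left hue K.2)) h1
  · have := hc _ (hψt x) _ (hψt y)
    rwa [hψ, hψ] at this

/-! ### Norm and diameter of compact quotient groups -/

theorem Submodule.Quotient.norm_mk_eq_infDist {E : Type*} [NormedAddCommGroup E]
    (L : Submodule ℤ E) (x : E) :
    ‖(Submodule.Quotient.mk x : E ⧸ L)‖ = Metric.infDist x (L : Set E) :=
  QuotientAddGroup.norm_mk (S := L.toAddSubgroup) x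

/-- By translation invariance every distance is a norm, so the diameter is the maximum of the norm,
attained by compactness. -/
theorem exists_norm_eq_diam_univ (G : Type*) [SeminormedAddCommGroup G] [CompactSpace G] :
    ∃ x : G, ‖x‖ = Metric.diam (Set.univ : Set G) := by
  obtain ⟨x, -, hx⟩ := isCompact_univ.exists_isMaxOn (⟨0, trivial⟩ : (Set.univ : Set G).Nonempty)
    continuous_norm.continuousOn
  refine ⟨x, le_antisymm ?_ (Metric.diam_le_of_forall_dist_le (norm_nonneg x) fun y _ z _ => ?_)⟩
  · simpa using Metric.dist_le_diam_of_mem isCompact_univ.isBounded (Set.mem_univ x)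
      (Set.mem_univ 0)
  · rw [dist_eq_norm]
    exact hx (Set.mem_univ (y - z))

theorem norm_le_diam_univ {G : Type*} [SeminormedAddCommGroup G] [CompactSpace G] (x : G) :
    ‖x‖ ≤ Metric.diam (Set.univ : Set G) := by
  simpa using Metric.dist_le_diam_of_mem isCompact_univ.isBounded (Set.mem_univ x)
    (Set.mem_univ 0)

/-! ### Limits of closed subgroups of Euclidean space -/

/-- Sequential compactness of uniformly cocompact subgroups, in terms of distance functions. -/
theorem AddSubgroup.exists_subseq_tendsto_infDist {E : Type*} [NormedAddCommGroup E]
    [ProperSpace E] (L : ℕ → AddSubgroup E) {ρ : ℝ}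
    (hρ : ∀ i x, Metric.infDist x (L i : Set E) ≤ ρ) :
    ∃ φ : ℕ → ℕ, StrictMono φ ∧ ∃ Γ : AddSubgroup E, IsClosed (Γ : Set E) ∧
      ∀ x, Tendsto (fun i => Metric.infDist x (L (φ i) : Set E)) atTop
        (𝓝 (Metric.infDist x (Γ : Set E))) := by
  have hne : ∀ i, (L i : Set E).Nonempty := fun i => ⟨0, (L i).zero_mem⟩
  -- Tychonoff: the distances to a dense sequence of points lie in the compact product of the
  -- intervals `[0, ρ]`.
  obtain ⟨a, -, φ, hφ, ha⟩ := (isCompact_univ_pi fun _ : ℕ =>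
    isCompact_Icc (a := (0 : ℝ)) (b := ρ)).tendsto_subseq
    (x := fun i n => Metric.infDist (TopologicalSpace.denseSeq E n) (L i : Set E))
    fun i n _ => ⟨Metric.infDist_nonneg, hρ i _⟩
  rw [tendsto_pi_nhds] at ha
  -- Distance functions are 1-Lipschitz, so convergence on a dense set gives convergence everywhere.
  have hcauchy : ∀ x, CauchySeq fun i => Metric.infDist x (L (φ i) : Set E) := by
    intro x
    rw [Metric.cauchySeq_iff']
    intro ε hε
    obtain ⟨n, hn⟩ := (TopologicalSpace.denseRange_denseSeq E).exists_dist_lt x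
      (show 0 < ε / 4 by positivity)
    obtain ⟨N, hN⟩ := Metric.cauchySeq_iff'.1 (ha n).cauchySeq (ε / 2) (by positivity)
    refine ⟨N, fun i hi => ?_⟩
    have h0 := hN i hi
    have h : ∀ j, |Metric.infDist x (L j : Set E)
        - Metric.infDist (TopologicalSpace.denseSeq E n) (L j : Set E)| ≤ ε / 4 := fun j => by
      have := (Metric.lipschitz_infDist_pt (L j : Set E)).dist_le_mul x
        (TopologicalSpace.denseSeq E n)
      rw [Real.dist_eq, NNReal.coe_one, one_mul] at this
      exact this.trans hn.le
    have h1 := abs_le.1 (h (φ i))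
    have h2 := abs_le.1 (h (φ N))
    rw [Real.dist_eq, abs_lt] at h0 ⊢
    simp only [Function.comp_apply] at h0
    constructor <;> linarith [h0.1, h0.2]
  choose f hf using fun x => cauchySeq_tendsto_of_complete (hcauchy x)
  have hf_nonneg : ∀ x, 0 ≤ f x := fun x => ge_of_tendsto' (hf x) fun i => Metric.infDist_nonneg
  have hf_lip : ∀ x y, f x ≤ f y + dist x y := fun x y =>
    le_of_tendsto_of_tendsto' (hf x) ((hf y).add_const _)
      fun i => Metric.infDist_le_infDist_add_dist
  have hf_zero : f 0 = 0 := by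
    refine tendsto_nhds_unique (hf 0) ?_
    simp [Metric.infDist_zero_of_mem (L _).zero_mem]
  have hL_add : ∀ i x y, Metric.infDist (x + y) (L i : Set E) ≤
      Metric.infDist x (L i : Set E) + Metric.infDist y (L i : Set E) := fun i x y => by
    simpa only [← QuotientAddGroup.mk_add, QuotientAddGroup.norm_mk] using
      norm_add_le (QuotientAddGroup.mk x : E ⧸ L i) (QuotientAddGroup.mk y)
  have hL_neg : ∀ i x, Metric.infDist (-x) (L i : Set E) = Metric.infDist x (L i : Set E) :=
    fun i x => by
      simpa only [← QuotientAddGroup.mk_neg, QuotientAddGroup.norm_mk] using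
        norm_neg (QuotientAddGroup.mk x : E ⧸ L i)
  have hf_add : ∀ x y, f (x + y) ≤ f x + f y := fun x y =>
    le_of_tendsto_of_tendsto' (hf _) ((hf x).add (hf y)) fun i => hL_add _ x y
  have hf_neg : ∀ x, f (-x) = f x := fun x =>
    tendsto_nhds_unique (hf (-x)) (by simpa only [hL_neg] using hf x)
  -- The limit `f` inherits subadditivity and symmetry, so its zero set is a subgroup. It remains to
  -- see that `f` is the distance to that set.
  let Γ : AddSubgroup E :=
    { carrier := {x | f x = 0}
      zero_mem' := hf_zero
      add_mem' := fun {x y} hx hy => by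
        change f x = 0 at hx
        change f y = 0 at hy
        exact le_antisymm ((hf_add x y).trans_eq (by rw [hx, hy, add_zero])) (hf_nonneg _)
      neg_mem' := fun {x} hx => (hf_neg x).trans hx }
  have hf_cont : Continuous f := by
    refine (LipschitzWith.of_le_add fun x y => hf_lip x y).continuous
  refine ⟨φ, hφ, Γ, isClosed_eq hf_cont continuous_const, fun x => ?_⟩
  suffices h : Metric.infDist x (Γ : Set E) = f x by
    rw [h]
    exact hf x
  refine le_antisymm ?_ ?_
  -- Almost nearest points of `L (φ i)` to `x` stay in a fixed ball because of `ρ`. They accumulate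
  -- at a point `y` of `Γ` that realizes the limit distance.
  · have hex : ∀ i, ∃ l ∈ L (φ i), dist x l < Metric.infDist x (L (φ i) : Set E)
        + 1 / ((i : ℝ) + 1) := fun i => by
      refine (Metric.infDist_lt_iff (hne (φ i))).1 (lt_add_of_pos_right _ ?_)
      positivity
    choose l hlL hl using hex
    have hbd : ∀ i, l i ∈ Metric.closedBall x (ρ + 1) := fun i => by
      rw [Metric.mem_closedBall, dist_comm]
      refine (hl i).le.trans (add_le_add (hρ _ _) ?_)
      rw [div_le_one (by positivity)]
      linarith [(Nat.cast_nonneg i : (0 : ℝ) ≤ i)]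
    obtain ⟨y, -, ψ, hψ, hy⟩ := (isCompact_closedBall x (ρ + 1)).tendsto_subseq hbd
    have hyΓ : y ∈ Γ := by
      refine le_antisymm (ge_of_tendsto' (x := atTop)
        (f := fun i => dist y (l (ψ i)) + (f y -
          Metric.infDist y (L (φ (ψ i)) : Set E))) ?_ fun i => ?_) (hf_nonneg _)
      · have h1 : Tendsto (fun i => dist y (l (ψ i))) atTop (𝓝 0) := by
          simpa using (tendsto_const_nhds (x := y)).dist hy
        simpa using h1.add ((tendsto_const_nhds (x := f y)).sub
          ((hf y).comp hψ.tendsto_atTop))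
      · have := Metric.infDist_le_dist_of_mem (x := y) (hlL (ψ i))
        linarith
    refine (Metric.infDist_le_dist_of_mem hyΓ).trans ?_
    refine le_of_tendsto_of_tendsto' ((tendsto_const_nhds (x := x)).dist hy)
      (((hf x).add tendsto_one_div_add_atTop_nhds_zero_nat).comp hψ.tendsto_atTop |>.trans
        (by rw [add_zero])) fun i => (hl (ψ i)).le
  · refine (Metric.le_infDist ⟨0, Γ.zero_mem⟩).2 fun y hy => ?_
    have := hf_lip x y
    rwa [show f y = 0 from hy, zero_add] at this

/-- A closed subgroup that contains no line is discrete. -/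
theorem AddSubgroup.discreteTopology_of_isClosed {E : Type*} [NormedAddCommGroup E]
    [NormedSpace ℝ E] [FiniteDimensional ℝ E] (Γ : AddSubgroup E) (hΓ : IsClosed (Γ : Set E))
    (hline : ∀ x, (∀ t : ℝ, t • x ∈ Γ) → x = 0) : DiscreteTopology Γ := by
  have := FiniteDimensional.proper_real E
  suffices h : ∃ ε > 0, ∀ x ∈ Γ, ‖x‖ < ε → x = 0 by
    obtain ⟨ε, hε, h⟩ := h
    refine discreteTopology_of_isOpen_singleton_zero (Metric.isOpen_iff.2 fun x hx => ?_)
    rw [Set.mem_singleton_iff] at hx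
    subst hx
    refine ⟨ε, hε, fun y hy => ?_⟩
    exact Subtype.ext (h y y.2 (by simpa [Subtype.dist_eq] using hy))
  by_contra! hcon
  choose x hxΓ hx hx0 using fun i : ℕ => hcon (1 / ((i : ℝ) + 1)) (by positivity)
  have hlim : Tendsto (fun i => ‖x i‖) atTop (𝓝 0) :=
    squeeze_zero (fun i => norm_nonneg _) (fun i => (hx i).le)
      tendsto_one_div_add_atTop_nhds_zero_nat
  have hu : ∀ i, ‖x i‖⁻¹ • x i ∈ Metric.sphere (0 : E) 1 := fun i => by
    simp [norm_smul, hx0 i]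
  obtain ⟨u, hu1, φ, hφ, hu⟩ := (isCompact_sphere (0 : E) 1).tendsto_subseq hu
  suffices u = 0 by simp [this] at hu1
  refine hline u fun t => ?_
  -- Integer multiples of shorter and shorter elements approximate every point of the line in the
  -- limit direction `u`, so the closed group contains that line.
  have hmem : ∀ i, ⌊t * ‖x (φ i)‖⁻¹⌋ • x (φ i) ∈ (Γ : Set E) := fun i => Γ.zsmul_mem (hxΓ _) _
  refine hΓ.mem_of_tendsto (b := atTop) (f := fun i => ⌊t * ‖x (φ i)‖⁻¹⌋ • x (φ i)) ?_
    (Eventually.of_forall hmem)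
  have h1 : Tendsto (fun i => t • (‖x (φ i)‖⁻¹ • x (φ i))) atTop (𝓝 (t • u)) :=
    hu.const_smul t
  have h2 : Tendsto (fun i => t • (‖x (φ i)‖⁻¹ • x (φ i)) - ⌊t * ‖x (φ i)‖⁻¹⌋ • x (φ i))
      atTop (𝓝 0) := by
    refine squeeze_zero_norm (fun i => ?_) (hlim.comp hφ.tendsto_atTop)
    rw [← Int.cast_smul_eq_zsmul ℝ, smul_smul, ← sub_smul, Int.self_sub_floor, norm_smul,
      Real.norm_eq_abs, Int.abs_fract]
    exact mul_le_of_le_one_left (norm_nonneg _) (Int.fract_lt_one _).le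
  simpa using h1.sub h2

/-- The largest real subspace contained in a subgroup. -/
def AddSubgroup.lineSpace {E : Type*} [AddCommGroup E] [Module ℝ E] (Γ : AddSubgroup E) :
    Submodule ℝ E where
  carrier := {x | ∀ t : ℝ, t • x ∈ Γ}
  zero_mem' := fun t => by simp [Γ.zero_mem]
  add_mem' := fun hx hy t => by
    rw [smul_add]
    exact Γ.add_mem (hx t) (hy t)
  smul_mem' := fun c x hx t => by
    rw [smul_smul]
    exact hx _

theorem AddSubgroup.mem_lineSpace {E : Type*} [AddCommGroup E] [Module ℝ E]
    {Γ : AddSubgroup E} {x : E} : x ∈ Γ.lineSpace ↔ ∀ t : ℝ, t • x ∈ Γ := Iff.rfl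

theorem AddSubgroup.lineSpace_le {E : Type*} [AddCommGroup E] [Module ℝ E]
    {Γ : AddSubgroup E} {x : E} (hx : x ∈ Γ.lineSpace) : x ∈ Γ := by
  simpa using mem_lineSpace.1 hx 1

/-- The quotient by a closed cocompact subgroup is a flat torus. -/
theorem AddSubgroup.exists_flatTorus {E : Type*} [NormedAddCommGroup E] [InnerProductSpace ℝ E]
    [FiniteDimensional ℝ E] (Γ : AddSubgroup E) (hΓ : IsClosed (Γ : Set E)) {ρ : ℝ}
    (hρ : ∀ x, Metric.infDist x (Γ : Set E) ≤ ρ) :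
    ∃ (T : FlatTorus (Module.finrank ℝ Γ.lineSpaceᗮ))
      (τ : E →ₗ[ℝ] EuclideanSpace ℝ (Fin (Module.finrank ℝ Γ.lineSpaceᗮ))),
      Function.Surjective τ ∧ ∀ x,
        ‖(Submodule.Quotient.mk (τ x) : T.Space)‖ = Metric.infDist x (Γ : Set E) := by
  set K := Γ.lineSpace with hK
  have hΓ0 : (Γ : Set E).Nonempty := ⟨0, Γ.zero_mem⟩
  let ι := (stdOrthonormalBasis ℝ Kᗮ).repr
  let j : EuclideanSpace ℝ (Fin (Module.finrank ℝ Kᗮ)) →ₗᵢ[ℝ] E :=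
    Kᗮ.subtypeₗᵢ.comp ι.symm.toLinearIsometry
  let τ : E →ₗ[ℝ] EuclideanSpace ℝ (Fin (Module.finrank ℝ Kᗮ)) :=
    ι.toLinearEquiv.toLinearMap ∘ₗ Kᗮ.orthogonalProjectionOnto.toLinearMap
  have hjK : ∀ y, j y ∈ Kᗮ := fun y => (ι.symm y).2
  have hτj : ∀ y, τ (j y) = y := fun y => by
    change ι (Kᗮ.orthogonalProjectionOnto (ι.symm y : E)) = y
    rw [Submodule.orthogonalProjectionOnto_mem_subspace_eq_self, ι.apply_symm_apply]
  have hjτ : ∀ x, j (τ x) = Kᗮ.starProjection x := fun x => by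
    change ((ι.symm (ι (Kᗮ.orthogonalProjectionOnto x)) : Kᗮ) : E) = _
    rw [ι.symm_apply_apply, Submodule.coe_orthogonalProjectionOnto_apply]
  have hdecomp : ∀ x, K.starProjection x + j (τ x) = x := fun x => by
    rw [hjτ, Submodule.starProjection_add_starProjection_orthogonal]
  have hKΓ : ∀ x, K.starProjection x ∈ Γ := fun x =>
    lineSpace_le (K.starProjection_apply_mem x)
  -- In orthonormal coordinates of `Kᗮ` this is `Γ ∩ Kᗮ`. As `K ⊆ Γ`, it is also the projection of
  -- `Γ`.
  let L₀ : AddSubgroup (EuclideanSpace ℝ (Fin (Module.finrank ℝ Kᗮ))) :=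
    Γ.comap j.toLinearMap.toAddMonoidHom
  have hL₀ : ∀ y, y ∈ L₀ ↔ j y ∈ Γ := fun y => Iff.rfl
  have hτΓ : ∀ γ ∈ Γ, τ γ ∈ L₀ := fun γ hγ => by
    rw [hL₀, ← add_sub_cancel_left (K.starProjection γ) (j (τ γ)), hdecomp]
    exact Γ.sub_mem hγ (hKΓ γ)
  -- A line inside `Γ ∩ Kᗮ` would lie in `K` by maximality, hence be zero.
  have hdisc : DiscreteTopology L₀ := by
    refine L₀.discreteTopology_of_isClosed (hΓ.preimage j.continuous) fun y hy => ?_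
    have h1 : j y ∈ K := fun t => by
      rw [← map_smul]
      exact hy t
    have h2 : inner ℝ (j y) (j y) = 0 := Submodule.inner_right_of_mem_orthogonal h1 (hjK y)
    rw [inner_self_eq_zero] at h2
    exact j.injective (by rw [h2, map_zero])
  -- Projection does not increase distances; conversely, a point of `L₀` can be shifted along `K`
  -- inside `Γ` until it has the same `K`-component as `x`.
  have hdist : ∀ x, Metric.infDist (τ x) (L₀ : Set _) = Metric.infDist x (Γ : Set E) := by
    intro x
    refine le_antisymm ((Metric.le_infDist hΓ0).2 fun γ hγ => ?_)
      ((Metric.le_infDist ⟨0, L₀.zero_mem⟩).2 fun l hl => ?_)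
    · refine (Metric.infDist_le_dist_of_mem (hτΓ γ hγ)).trans ?_
      rw [← j.isometry.dist_eq, dist_eq_norm, dist_eq_norm, hjτ, hjτ, ← map_sub]
      exact Submodule.norm_starProjection_apply_le _ _
    · have hmem : K.starProjection x + j l ∈ Γ := Γ.add_mem (hKΓ x) hl
      refine (Metric.infDist_le_dist_of_mem hmem).trans_eq ?_
      rw [← j.isometry.dist_eq]
      conv_lhs => rw [← hdecomp x]
      rw [dist_eq_norm, dist_eq_norm]
      congr 1
      simp only [map_add]
      have h' : K.starProjection (K.starProjection x) = K.starProjection x :=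
        K.starProjection_eq_self_iff.2 (K.starProjection_apply_mem x)
      have h'' : K.starProjection (j (τ x)) = 0 :=
        K.starProjection_apply_eq_zero_iff.2 (hjK _)
      simp [h', h'']
  let L := L₀.toIntSubmodule
  have : DiscreteTopology L := hdisc
  have hspan : Submodule.span ℝ (L : Set (EuclideanSpace ℝ (Fin (Module.finrank ℝ Kᗮ)))) = ⊤ := by
    rw [← Submodule.orthogonal_eq_bot_iff, Submodule.eq_bot_iff]
    intro y hy
    by_contra hy0
    have hy' : 0 < ‖y‖ := norm_pos_iff.2 hy0
    -- A vector orthogonal to the lattice is at least its own length away from it; length `|ρ| + 1`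
    -- contradicts the covering bound.
    set c := (|ρ| + 1) / ‖y‖ with hc
    have h1 := hρ (j (c • y))
    rw [← hdist, hτj] at h1
    obtain ⟨l, hl, hlt⟩ := (Metric.infDist_lt_iff ⟨0, L₀.zero_mem⟩).1
      (h1.trans_lt ((le_abs_self ρ).trans_lt (lt_add_one _)))
    have horth : inner ℝ (c • y) l = 0 := by
      rw [inner_smul_left, Submodule.inner_left_of_mem_orthogonal (Submodule.subset_span hl) hy,
        mul_zero]
    have h2 := norm_sub_sq_eq_norm_sq_add_norm_sq_real horth
    have h3 : ‖c • y‖ = |ρ| + 1 := by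
      rw [norm_smul, Real.norm_of_nonneg (by positivity), hc, div_mul_cancel₀ _ hy'.ne']
    rw [dist_eq_norm] at hlt
    rw [h3] at h2
    nlinarith [norm_nonneg (c • y - l), norm_nonneg l, abs_nonneg ρ]
  have : IsZLattice ℝ L := ⟨hspan⟩
  refine ⟨⟨L⟩, τ, fun y => ⟨j y, hτj y⟩, fun x => ?_⟩
  rw [← hdist]
  exact Submodule.Quotient.norm_mk_eq_infDist L (τ x)

/-- Rounding the `m` coefficients down to integers moves the point by at most `ε` per generator. -/
theorem AddSubgroup.infDist_le_of_mem_span {E : Type*} [NormedAddCommGroup E] [NormedSpace ℝ E]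
    (L : AddSubgroup E) {m : ℕ} (w : Fin m → E) (hw : ∀ j, w j ∈ L) {ε : ℝ}
    (hε : ∀ j, ‖w j‖ ≤ ε) {x : E} (hx : x ∈ Submodule.span ℝ (Set.range w)) :
    Metric.infDist x (L : Set E) ≤ m * ε := by
  obtain ⟨c, rfl⟩ := (Submodule.mem_span_range_iff_exists_fun ℝ).1 hx
  have hmem : ∑ j, ⌊c j⌋ • w j ∈ L := L.sum_mem fun j _ => L.zsmul_mem (hw j) _
  refine (Metric.infDist_le_dist_of_mem hmem).trans ?_
  rw [dist_eq_norm, ← Finset.sum_sub_distrib]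
  refine (norm_sum_le_of_le _ (f := fun j => c j • w j - ⌊c j⌋ • w j) (n := fun _ => ε)
    fun j _ => ?_).trans_eq (by simp)
  rw [← Int.cast_smul_eq_zsmul ℝ, ← sub_smul, Int.self_sub_floor, norm_smul,
    Real.norm_eq_abs, Int.abs_fract]
  exact (mul_le_of_le_one_left (norm_nonneg _) (Int.fract_lt_one _).le).trans (hε j)

/-- Independent lattice vectors that tend to zero produce lines in the limit group. -/
theorem AddSubgroup.finrank_lineSpace_orthogonal_add_le {E : Type*} [NormedAddCommGroup E]
    [InnerProductSpace ℝ E] [FiniteDimensional ℝ E] (L : ℕ → AddSubgroup E) (Γ : AddSubgroup E)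
    (hΓ : IsClosed (Γ : Set E))
    (hlim : ∀ x, Tendsto (fun i => Metric.infDist x (L i : Set E)) atTop
      (𝓝 (Metric.infDist x (Γ : Set E)))) {m : ℕ} (w : ℕ → Fin m → E)
    (hw : ∀ i j, w i j ∈ L i) (hind : ∀ i, LinearIndependent ℝ (w i)) (ε : ℕ → ℝ)
    (hε : Tendsto ε atTop (𝓝 0)) (hwε : ∀ i j, ‖w i j‖ ≤ ε i) :
    Module.finrank ℝ Γ.lineSpaceᗮ + m ≤ Module.finrank ℝ E := by
  have := FiniteDimensional.proper_real E
  by_contra! hcon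
  -- If the dimensions were too large, `Kᗮ` would meet each span of short vectors in a unit vector.
  -- A limit `v` of these lies in `Kᗮ`, and its whole line lies in `Γ` since the spans are filled
  -- ever more densely by `L i`. So `v ∈ K ∩ Kᗮ = 0`, a contradiction.
  have hex : ∀ i, ∃ u ∈ Submodule.span ℝ (Set.range (w i)), u ∈ Γ.lineSpaceᗮ ∧ ‖u‖ = 1 := by
    intro i
    have hnd : ¬ Disjoint Γ.lineSpaceᗮ (Submodule.span ℝ (Set.range (w i))) := fun hd => by
      have := Submodule.finrank_add_finrank_le_of_disjoint hd
      rw [finrank_span_eq_card (hind i), Fintype.card_fin] at this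
      omega
    rw [disjoint_iff] at hnd
    obtain ⟨u, hu, hu0⟩ := Submodule.exists_mem_ne_zero_of_ne_bot hnd
    refine ⟨‖u‖⁻¹ • u, Submodule.smul_mem _ _ hu.2, Submodule.smul_mem _ _ hu.1, ?_⟩
    simp [norm_smul, hu0]
  choose u huw huK hu1 using hex
  obtain ⟨v, hv1, φ, hφ, hv⟩ := (isCompact_sphere (0 : E) 1).tendsto_subseq
    (x := u) fun i => by simp [hu1 i]
  have hvK : v ∈ Γ.lineSpaceᗮ := (Submodule.isClosed_orthogonal _).mem_of_tendsto hv
    (Eventually.of_forall fun i => huK _)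
  have hvΓ : v ∈ Γ.lineSpace := by
    intro t
    refine (hΓ.mem_iff_infDist_zero ⟨0, Γ.zero_mem⟩).2 (le_antisymm ?_ Metric.infDist_nonneg)
    refine le_of_tendsto_of_tendsto' ((hlim (t • v)).comp hφ.tendsto_atTop)
      (g := fun i => m * ε (φ i) + dist (t • v) (t • u (φ i))) ?_ fun i => ?_
    · have h1 := ((hε.comp hφ.tendsto_atTop).const_mul (m : ℝ)).add
        ((tendsto_const_nhds (x := t • v)).dist (hv.const_smul t))
      simpa using h1
    · refine Metric.infDist_le_infDist_add_dist.trans (add_le_add_left ?_ _)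
      exact (L (φ i)).infDist_le_of_mem_span (w (φ i)) (hw _) (hwε _)
        (Submodule.smul_mem _ _ (huw _))
  have h0 : inner ℝ v v = 0 := Submodule.inner_right_of_mem_orthogonal hvΓ hvK
  rw [inner_self_eq_zero] at h0
  simp [h0] at hv1

/-! ### Abelian varieties with short Lagrangian vectors -/

theorem AddSubgroup.infDist_map_eq {E F : Type*} [NormedAddCommGroup E] [NormedSpace ℝ E]
    [NormedAddCommGroup F] [NormedSpace ℝ F] (e : E ≃ₗ[ℝ] F) {D : ℝ} (hD : 0 < D)
    (he : ∀ x, ‖e x‖ = D * ‖x‖) (Λ : AddSubgroup F) (x : E) :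
    Metric.infDist (e x) (Λ : Set F) =
      D * Metric.infDist x (Λ.comap e.toLinearMap.toAddMonoidHom : Set E) := by
  have hdist : ∀ a b, dist (e a) (e b) = D * dist a b := fun a b => by
    rw [dist_eq_norm, ← map_sub, he, dist_eq_norm]
  refine le_antisymm ?_ ((Metric.le_infDist ⟨0, Λ.zero_mem⟩).2 fun y hy => ?_)
  · rw [← div_le_iff₀' hD]
    refine (Metric.le_infDist ⟨0, AddSubgroup.zero_mem _⟩).2 fun l hl => ?_
    rw [div_le_iff₀' hD, ← hdist]
    exact Metric.infDist_le_dist_of_mem hl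
  · rw [← e.apply_symm_apply y, hdist]
    refine mul_le_mul_of_nonneg_left (Metric.infDist_le_dist_of_mem ?_) hD.le
    change e (e.symm y) ∈ Λ
    rwa [e.apply_symm_apply]

theorem unitScale_val {X : Type*} [MetricSpace X] (h : 0 < Metric.diam (Set.univ : Set X)) :
    (unitScale X).1 = (Metric.diam (Set.univ : Set X))⁻¹ := by
  simp [unitScale, h]

/-- Spaces of the form `E ⧸ L i`, of covering radius `1`, with `m` independent vectors of `L i`
tending to zero, subconverge to a flat torus of dimension at most `dim E - m`. -/
theorem AddSubgroup.exists_subseq_tendsto_flatTorus {E : Type*} [NormedAddCommGroup E]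
    [InnerProductSpace ℝ E] [FiniteDimensional ℝ E] {X : ℕ → Type} [∀ i, MetricSpace (X i)]
    [∀ i, CompactSpace (X i)] [∀ i, Nonempty (X i)] (L : ℕ → AddSubgroup E) (p : ∀ i, E → X i)
    (hp : ∀ i, Function.Surjective (p i))
    (hdist : ∀ i x y, dist (p i x) (p i y) = Metric.infDist (x - y) (L i : Set E))
    (hle : ∀ i x, Metric.infDist x (L i : Set E) ≤ 1)
    (heq : ∀ i, ∃ x, Metric.infDist x (L i : Set E) = 1) {m : ℕ} (w : ℕ → Fin m → E)
    (hw : ∀ i j, w i j ∈ L i) (hind : ∀ i, LinearIndependent ℝ (w i)) (ε : ℕ → ℝ)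
    (hε : Tendsto ε atTop (𝓝 0)) (hwε : ∀ i j, ‖w i j‖ ≤ ε i) :
    ∃ φ : ℕ → ℕ, StrictMono φ ∧ ∃ d : ℕ, 0 < d ∧ d + m ≤ Module.finrank ℝ E ∧
      ∃ T : FlatTorus d, T.diam = 1 ∧
        Tendsto (fun i => GromovHausdorff.toGHSpace (X (φ i))) atTop (𝓝 T.toGH) := by
  have := FiniteDimensional.proper_real E
  obtain ⟨φ, hφ, Γ, hΓ, hlim⟩ := AddSubgroup.exists_subseq_tendsto_infDist L hle
  have hΓle : ∀ x, Metric.infDist x (Γ : Set E) ≤ 1 := fun x =>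
    le_of_tendsto' (hlim x) fun i => hle _ x
  have hrank := AddSubgroup.finrank_lineSpace_orthogonal_add_le (fun i => L (φ i)) Γ hΓ hlim
    (fun i => w (φ i)) (fun i => hw (φ i)) (fun i => hind (φ i)) (fun i => ε (φ i))
    (hε.comp hφ.tendsto_atTop) fun i => hwε (φ i)
  obtain ⟨d, hd, T, τ, hτ, hT⟩ : ∃ d, d = Module.finrank ℝ Γ.lineSpaceᗮ ∧
      ∃ (T : FlatTorus d) (τ : E →ₗ[ℝ] EuclideanSpace ℝ (Fin d)),
        Function.Surjective τ ∧ ∀ x,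
          ‖(Submodule.Quotient.mk (τ x) : T.Space)‖ = Metric.infDist x (Γ : Set E) :=
    ⟨_, rfl, Γ.exists_flatTorus hΓ hΓle⟩
  -- Covering radius `1` lets every coset meet the ball of radius `2`, which then serves as a common
  -- compact parameter set.
  have hnear : ∀ (M : AddSubgroup E) x, Metric.infDist x (M : Set E) ≤ 1 →
      ∃ y ∈ Metric.closedBall (0 : E) 2, x - y ∈ M := fun M x hx => by
    obtain ⟨γ, hγ, hlt⟩ := (Metric.infDist_lt_iff ⟨0, M.zero_mem⟩).1 (hx.trans_lt one_lt_two)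
    refine ⟨x - γ, ?_, by rwa [sub_sub_cancel]⟩
    rw [mem_closedBall_zero_iff, ← dist_eq_norm]
    exact hlt.le
  have hTdist : ∀ x y, dist (Submodule.Quotient.mk (τ x) : T.Space) (Submodule.Quotient.mk (τ y))
      = Metric.infDist (x - y) (Γ : Set E) := fun x y => by
    rw [dist_eq_norm, ← Submodule.Quotient.mk_sub, ← map_sub, hT]
  have hTsurj : ∀ z : T.Space, ∃ x, Submodule.Quotient.mk (τ x) = z := fun z => by
    obtain ⟨y, rfl⟩ := Submodule.Quotient.mk_surjective _ z
    obtain ⟨x, rfl⟩ := hτ y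
    exact ⟨x, rfl⟩
  have hTdiam : T.diam = 1 := by
    refine le_antisymm (Metric.diam_le_of_forall_dist_le zero_le_one fun y _ z _ => ?_) ?_
    · obtain ⟨y, rfl⟩ := hTsurj y
      obtain ⟨z, rfl⟩ := hTsurj z
      rw [hTdist]
      exact hΓle _
    -- Deepest points of the approximating quotients, moved into this ball, accumulate at a point of
    -- distance at least `1` from `Γ`.
    · have hex : ∀ i, ∃ y ∈ Metric.closedBall (0 : E) 2,
          Metric.infDist y (L (φ i) : Set E) = 1 := fun i => by
        obtain ⟨x, hx⟩ := heq (φ i)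
        obtain ⟨y, hy, hxy⟩ := hnear (L (φ i)) x hx.le
        refine ⟨y, hy, ?_⟩
        rw [← sub_zero y, ← hdist, ← hx, ← sub_zero x, ← hdist]
        have : p (φ i) x = p (φ i) y := by
          rw [← dist_eq_zero, hdist]
          exact Metric.infDist_zero_of_mem hxy
        rw [this]
      choose y hy hy1 using hex
      obtain ⟨z, -, θ, hθ, hz⟩ := (isCompact_closedBall _ _).tendsto_subseq hy
      have h1 : (1 : ℝ) ≤ Metric.infDist z (Γ : Set E) := by
        refine ge_of_tendsto' (x := atTop) (f := fun i =>
          Metric.infDist z (L (φ (θ i)) : Set E) + dist (y (θ i)) z) ?_ fun i => ?_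
        · have h2 : Tendsto (fun i => dist (y (θ i)) z) atTop (𝓝 0) := by
            simpa using hz.dist (tendsto_const_nhds (x := z))
          simpa using ((hlim z).comp hθ.tendsto_atTop).add h2
        · rw [← hy1 (θ i)]
          exact Metric.infDist_le_infDist_add_dist
      refine h1.trans ?_
      rw [← hT]
      exact norm_le_diam_univ (Submodule.Quotient.mk (τ z) : T.Space)
  refine ⟨φ, hφ, d, Nat.pos_of_ne_zero fun h => ?_, hd ▸ hrank, T, hTdiam, ?_⟩
  · subst h
    refine one_ne_zero (hTdiam.symm.trans (le_antisymm
      (Metric.diam_le_of_forall_dist_le le_rfl fun y _ z _ => ?_) Metric.diam_nonneg))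
    obtain ⟨y, rfl⟩ := Submodule.Quotient.mk_surjective _ y
    obtain ⟨z, rfl⟩ := Submodule.Quotient.mk_surjective _ z
    rw [Subsingleton.elim y z, dist_self]
  · refine tendsto_toGHSpace_of_tendsto_dist (isCompact_closedBall (0 : E) 2).totallyBounded
      (fun i => p (φ i)) (fun x => (Submodule.Quotient.mk (τ x) : T.Space)) 1 ?_ ?_ ?_ ?_
    · refine Eventually.of_forall fun i => LipschitzWith.of_dist_le_mul fun x y => ?_
      rw [hdist, NNReal.coe_one, one_mul]
      refine (Metric.infDist_le_dist_of_mem (L (φ i)).zero_mem).trans_eq ?_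
      rw [dist_zero_right, dist_eq_norm]
    · refine Eventually.of_forall fun i x => ?_
      obtain ⟨x, rfl⟩ := hp (φ i) x
      obtain ⟨y, hy, hxy⟩ := hnear (L (φ i)) x (hle _ x)
      refine ⟨y, hy, ?_⟩
      rw [eq_comm, ← dist_eq_zero, hdist]
      exact Metric.infDist_zero_of_mem hxy
    · intro z
      obtain ⟨x, rfl⟩ := hTsurj z
      obtain ⟨y, hy, hxy⟩ := hnear Γ x (hΓle x)
      refine ⟨y, hy, ?_⟩
      rw [eq_comm, ← dist_eq_zero, hTdist]
      exact Metric.infDist_zero_of_mem hxy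
    · intro x y
      simp only [hdist, hTdist]
      exact hlim (x - y)

/-! ### Rescaled abelian varieties -/

namespace PPAV

variable {g : ℕ} (V : PPAV g)

theorem finrank_real_carrier : Module.finrank ℝ V.carrier = 2 * g := by
  rw [finrank_real_of_complex, V.finrank_eq]

/-- A real isometric coordinate system on the universal cover. -/
theorem nonempty_realCoordinates :
    Nonempty (EuclideanSpace ℝ (Fin (2 * g)) ≃ₗᵢ[ℝ] V.carrier) := by
  let := InnerProductSpace.complexToReal (G := V.carrier)
  exact ⟨((stdOrthonormalBasis ℝ V.carrier).reindex (finCongr V.finrank_real_carrier)).repr.symm⟩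

/-- A short lattice vector forces a large diameter, since `E` is integral. -/
theorem inv_two_mul_norm_le_diam {v : V.carrier} (hv : v ∈ V.lattice) (hv0 : v ≠ 0) :
    (2 * ‖v‖)⁻¹ ≤ Metric.diam (Set.univ : Set V.Space) := by
  have hpos : 0 < ‖v‖ := norm_pos_iff.2 hv0
  -- The multiple of `i v` that pairs with `v` to `1/2`. Lattice points pair with `v` to integers,
  -- so `|E(x - l, v)| ≥ 1/2`, and Cauchy–Schwarz bounds `‖x - l‖` from below.
  set x : V.carrier := (((2 * ‖v‖ ^ 2)⁻¹ : ℝ) * Complex.I : ℂ) • v with hx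
  refine le_trans ?_ (norm_le_diam_univ (Submodule.Quotient.mk x : V.Space))
  rw [Submodule.Quotient.norm_mk_eq_infDist]
  refine (Metric.le_infDist ⟨0, V.lattice.zero_mem⟩).2 fun l hl => ?_
  obtain ⟨m, hm⟩ := V.integral l hl v hv
  have hxv : (inner ℂ v x).im = 1 / 2 := by
    have : (inner ℂ v x) = (((2 * ‖v‖ ^ 2)⁻¹ * ‖v‖ ^ 2 : ℝ) : ℂ) * Complex.I := by
      rw [hx, inner_smul_right, inner_self_eq_norm_sq_to_K]
      push_cast
      simp only [Complex.coe_algebraMap]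
      ring
    rw [this, Complex.im_ofReal_mul, Complex.I_im]
    field_simp
  have h1 : (inner ℂ v (x - l)).im = 1 / 2 - m := by
    rw [inner_sub_right, Complex.sub_im, hxv, hm]
  have h2 : (1 : ℝ) / 2 ≤ |1 / 2 - (m : ℝ)| := by
    rcases le_or_gt m 0 with h | h
    · have : (m : ℝ) ≤ 0 := by exact_mod_cast h
      exact le_abs.2 (Or.inl (by linarith))
    · have : (1 : ℝ) ≤ m := by exact_mod_cast h
      exact le_abs.2 (Or.inr (by linarith))
  have h3 : |1 / 2 - (m : ℝ)| ≤ ‖v‖ * ‖x - l‖ := by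
    rw [← h1]
    exact (Complex.abs_im_le_norm _).trans (norm_inner_le_norm _ _)
  rw [dist_eq_norm, inv_le_iff_one_le_mul₀ (by positivity)]
  linarith

/-- The normalized variety as a quotient of `ℝ^{2g}` by a group of covering radius `1`. -/
theorem exists_parametrization (hD : 0 < Metric.diam (Set.univ : Set V.Space)) :
    ∃ (e : EuclideanSpace ℝ (Fin (2 * g)) ≃ₗ[ℝ] V.carrier)
      (p : EuclideanSpace ℝ (Fin (2 * g)) → Rescaled V.Space (unitScale V.Space))
      (L : AddSubgroup (EuclideanSpace ℝ (Fin (2 * g)))),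
      (∀ x, ‖e x‖ = Metric.diam (Set.univ : Set V.Space) * ‖x‖) ∧
      (∀ x, x ∈ L ↔ e x ∈ V.lattice) ∧ Function.Surjective p ∧
      (∀ x y, dist (p x) (p y) = Metric.infDist (x - y) (L : Set (EuclideanSpace ℝ (Fin (2 * g))))) ∧
      (∀ x, Metric.infDist x (L : Set (EuclideanSpace ℝ (Fin (2 * g)))) ≤ 1) ∧ ∃ x, Metric.infDist x (L : Set (EuclideanSpace ℝ (Fin (2 * g)))) = 1 := by
  obtain ⟨ι⟩ := V.nonempty_realCoordinates
  generalize hDdef : Metric.diam (Set.univ : Set V.Space) = D at hD ⊢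
  let e : EuclideanSpace ℝ (Fin (2 * g)) ≃ₗ[ℝ] V.carrier :=
    ι.toLinearEquiv.trans (LinearEquiv.smulOfNeZero ℝ _ D hD.ne')
  have he : ∀ x, ‖e x‖ = D * ‖x‖ := fun x => by
    change ‖D • ι x‖ = _
    rw [norm_smul, Real.norm_of_nonneg hD.le, LinearIsometryEquiv.norm_map]
  clear_value e
  let L : AddSubgroup (EuclideanSpace ℝ (Fin (2 * g))) :=
    V.lattice.toAddSubgroup.comap e.toLinearMap.toAddMonoidHom
  have hL : ∀ x, x ∈ L ↔ e x ∈ V.lattice := fun x => Iff.rfl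
  have hnorm : ∀ x, ‖(Submodule.Quotient.mk (e x) : V.Space)‖ =
      D * Metric.infDist x (L : Set (EuclideanSpace ℝ (Fin (2 * g)))) := fun x => by
    rw [Submodule.Quotient.norm_mk_eq_infDist]
    exact AddSubgroup.infDist_map_eq e hD he V.lattice.toAddSubgroup x
  clear_value L
  refine ⟨e, fun x => (Submodule.Quotient.mk (e x) : V.Space), L, he, hL, ?_, ?_, ?_, ?_⟩
  · exact (Submodule.Quotient.mk_surjective V.lattice).comp e.surjective
  · intro x y
    rw [Rescaled.dist_def, unitScale_val (hDdef ▸ hD), hDdef, dist_eq_norm,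
      ← Submodule.Quotient.mk_sub, ← map_sub, hnorm, inv_mul_cancel_left₀ hD.ne']
  · intro x
    have := norm_le_diam_univ (Submodule.Quotient.mk (e x) : V.Space)
    rw [hnorm, hDdef] at this
    exact le_of_mul_le_mul_left (this.trans_eq (mul_one D).symm) hD
  · obtain ⟨x, hx⟩ := exists_norm_eq_diam_univ V.Space
    obtain ⟨y, rfl⟩ := Submodule.Quotient.mk_surjective _ x
    obtain ⟨z, rfl⟩ := e.surjective y
    rw [hnorm, hDdef] at hx
    exact ⟨z, mul_left_cancel₀ hD.ne' (hx.trans (mul_one _).symm)⟩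

/-- A nonzero lattice vector shorter than `1` forces diameter at least `1/2`, so normalization at
most doubles the short vectors. -/
theorem exists_parametrization_of_short (hg : 0 < g) {ε : ℝ} (hε : ε ≤ 1)
    {w : Fin g → V.carrier} (hind : LinearIndependent ℝ w)
    (hw : ∀ j, w j ∈ V.lattice ∧ ‖w j‖ < ε) :
    ∃ (p : EuclideanSpace ℝ (Fin (2 * g)) → Rescaled V.Space (unitScale V.Space))
      (L : AddSubgroup (EuclideanSpace ℝ (Fin (2 * g))))
      (u : Fin g → EuclideanSpace ℝ (Fin (2 * g))),
      Function.Surjective p ∧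
      (∀ x y, dist (p x) (p y) = Metric.infDist (x - y) (L : Set (EuclideanSpace ℝ (Fin (2 * g))))) ∧
      (∀ x, Metric.infDist x (L : Set (EuclideanSpace ℝ (Fin (2 * g)))) ≤ 1) ∧ (∃ x, Metric.infDist x (L : Set (EuclideanSpace ℝ (Fin (2 * g)))) = 1) ∧
      LinearIndependent ℝ u ∧ ∀ j, u j ∈ L ∧ ‖u j‖ ≤ 2 * ε := by
  have hD2 : (1 : ℝ) / 2 ≤ Metric.diam (Set.univ : Set V.Space) := by
    have h0 := hind.ne_zero ⟨0, hg⟩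
    refine le_trans ?_ (V.inv_two_mul_norm_le_diam (hw ⟨0, hg⟩).1 h0)
    have h2 : 0 < ‖w ⟨0, hg⟩‖ := norm_pos_iff.2 h0
    rw [le_inv_comm₀ (by positivity) (by positivity), inv_div, div_one]
    linarith [(hw ⟨0, hg⟩).2]
  obtain ⟨e, p, L, he, hL, hp, hdist, hle, heq⟩ :=
    V.exists_parametrization (lt_of_lt_of_le (by norm_num) hD2)
  refine ⟨p, L, fun j => e.symm (w j), hp, hdist, hle, heq,
    hind.map' e.symm.toLinearMap (LinearEquiv.ker _), fun j => ⟨?_, ?_⟩⟩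
  · rw [hL, LinearEquiv.apply_symm_apply]
    exact (hw j).1
  · have h1 := he (e.symm (w j))
    rw [LinearEquiv.apply_symm_apply] at h1
    nlinarith [norm_nonneg (e.symm (w j)), (hw j).2]

/-- If the universal covers contain `g` independent lattice vectors that tend to zero, then the
normalized varieties subconverge to a flat torus of dimension at most `g`. -/
theorem exists_subseq_tendsto_flatTorus (hg : 0 < g) (V : ℕ → PPAV g)
    (hV : ∀ ε : ℝ, 0 < ε → ∀ᶠ i in atTop, ∃ w : Fin g → (V i).carrier,
      LinearIndependent ℝ w ∧ ∀ j, w j ∈ (V i).lattice ∧ ‖w j‖ < ε) :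
    ∃ φ : ℕ → ℕ, StrictMono φ ∧ ∃ r : ℕ, r < g ∧ ∃ T : FlatTorus (g - r), T.diam = 1 ∧
      Tendsto (fun i => (V (φ i)).toNormalizedGH) atTop (𝓝 T.toGH) := by
  -- A diagonal subsequence, along which the `n`-th variety has vectors shorter than `1 / (n + 1)`.
  obtain ⟨ψ, hψ, hw⟩ := extraction_forall_of_eventually' (fun n : ℕ =>
    eventually_atTop.1 (hV (1 / ((n : ℝ) + 1)) (by positivity)))
  have hle1 : ∀ n : ℕ, 1 / ((n : ℝ) + 1) ≤ 1 := fun n => by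
    rw [div_le_one (by positivity)]
    linarith [(Nat.cast_nonneg n : (0 : ℝ) ≤ n)]
  choose w hwind hw using hw
  have hpar := fun n => (V (ψ n)).exists_parametrization_of_short hg (hle1 n) (hwind n) (hw n)
  choose p L u hp hdist hle heq hind hu using hpar
  obtain ⟨φ, hφ, d, hd0, hd, T, hT, hlim⟩ := AddSubgroup.exists_subseq_tendsto_flatTorus L p hp
    hdist hle heq u (fun i j => (hu i j).1) hind (fun n => 2 * (1 / ((n : ℝ) + 1)))
    (by simpa using (tendsto_one_div_add_atTop_nhds_zero_nat (𝕜 := ℝ)).const_mul 2)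
    fun i j => (hu i j).2
  rw [finrank_euclideanSpace_fin] at hd
  -- Here `d + g ≤ 2 * g` gives `d ≤ g`, and `0 < d` gives `r < g`.
  obtain ⟨r, hr, rfl⟩ : ∃ r, r < g ∧ d = g - r := ⟨g - d, by omega, by omega⟩
  exact ⟨fun i => ψ (φ i), hψ.comp hφ, r, hr, T, hT, hlim⟩

end PPAV

/-! ### Short lattice vectors on the Siegel space -/

namespace SiegelSpace

open Matrix

variable {k : ℕ}

/-- The `2k × k` matrix with rows the generators of the lattice `ℤᵏ Z + ℤᵏ`. -/
def periods (Z : SiegelSpace k) : Matrix (Fin k ⊕ Fin k) (Fin k) ℂ :=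
  Matrix.fromRows Z.1 1

/-- The vector of `ℂᵏ` with real coordinates `c` in the basis of lattice generators. -/
def vec (Z : SiegelSpace k) (c : Fin k ⊕ Fin k → ℝ) : Fin k → ℂ :=
  (fun i => (c i : ℂ)) ᵥ* Z.periods

/-- The imaginary part, as a complex matrix. -/
def imPart (Z : SiegelSpace k) : Matrix (Fin k) (Fin k) ℂ :=
  (Z.1.map Complex.im).map Complex.ofRealHom

/-- The square of the norm of `Z.vec c` for the Hermitian metric `(Im Z)⁻¹`. -/
noncomputable def normSq (Z : SiegelSpace k) (c : Fin k ⊕ Fin k → ℝ) : ℝ :=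
  (Z.vec c ⬝ᵥ (Z.imPart⁻¹ *ᵥ star (Z.vec c))).re

theorem vec_apply (Z : SiegelSpace k) (c : Fin k ⊕ Fin k → ℝ) (j : Fin k) :
    Z.vec c j = ∑ i, (c (Sum.inl i) : ℂ) * Z.1 i j + c (Sum.inr j) := by
  simp [vec, periods, Matrix.vecMul, dotProduct, Matrix.one_apply]

theorem det_im_ne_zero (Z : SiegelSpace k) : (Z.1.map Complex.im).det ≠ 0 :=
  Z.2.2.det_pos.ne'

theorem det_imPart_ne_zero (Z : SiegelSpace k) : Z.imPart.det ≠ 0 := by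
  have : Z.imPart.det = Complex.ofRealHom (Z.1.map Complex.im).det :=
    (RingHom.map_det Complex.ofRealHom _).symm
  rw [this]
  exact (map_ne_zero _).2 Z.det_im_ne_zero

theorem imPart_inv (Z : SiegelSpace k) :
    Z.imPart⁻¹ = (Z.1.map Complex.im)⁻¹.map Complex.ofRealHom := by
  refine Matrix.inv_eq_right_inv ?_
  rw [imPart, ← Matrix.map_mul, Matrix.mul_nonsing_inv _ (isUnit_iff_ne_zero.2 Z.det_im_ne_zero)]
  simp

theorem normSq_eq (Z : SiegelSpace k) (c : Fin k ⊕ Fin k → ℝ) :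
    Z.normSq c =
      (fun j => (Z.vec c j).re) ⬝ᵥ ((Z.1.map Complex.im)⁻¹ *ᵥ fun j => (Z.vec c j).re) +
      (fun j => (Z.vec c j).im) ⬝ᵥ ((Z.1.map Complex.im)⁻¹ *ᵥ fun j => (Z.vec c j).im) := by
  rw [normSq, imPart_inv]
  simp only [dotProduct, Matrix.mulVec, Complex.re_sum, Finset.mul_sum, ← Finset.sum_add_distrib]
  refine Finset.sum_congr rfl fun i _ => Finset.sum_congr rfl fun j _ => ?_
  simp [Complex.mul_re, Complex.mul_im]

/-- Riemann's bilinear relation: it recovers `Im Z` from the symplectic form, so that the effect of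
a symplectic base change on `Im Z` can be read off. -/
theorem periods_conjTranspose_mul (Z : SiegelSpace k) :
    Z.periodsᴴ * Matrix.J (Fin k) ℂ * Z.periods = (2 * Complex.I) • Z.imPart := by
  have h : Z.periodsᴴ * Matrix.J (Fin k) ℂ * Z.periods = Z.1 - Z.1ᴴ := by
    rw [periods, Matrix.J, Matrix.conjTranspose_fromRows_eq_fromCols_conjTranspose,
      Matrix.fromCols_mul_fromBlocks, Matrix.fromCols_mul_fromRows]
    simp [sub_eq_add_neg]
  rw [h]
  ext i j
  have hs : Z.1 j i = Z.1 i j := congrFun (congrFun Z.2.1 i) j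
  rw [Matrix.sub_apply, Matrix.conjTranspose_apply, hs]
  apply Complex.ext
  · simp [imPart]
  · simp [imPart]
    ring

/-- The automorphy factor `K = C Z + D` is the complex linear map that identifies the two lattices,
up to the base change `M`. -/
theorem Rel.exists_mul_periods {Z W : SiegelSpace k} (h : Rel Z W) :
    ∃ M ∈ Matrix.symplecticGroup (Fin k) ℤ, ∃ K : Matrix (Fin k) (Fin k) ℂ,
      W.periods * K = M.map (Int.castRingHom ℂ) * Z.periods := by
  obtain ⟨M, hM, h⟩ := h
  refine ⟨M, hM, M.toBlocks₂₁.map (Int.cast : ℤ → ℂ) * Z.1 +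
    M.toBlocks₂₂.map (Int.cast : ℤ → ℂ), ?_⟩
  conv_rhs => rw [← Matrix.fromBlocks_toBlocks M]
  rw [periods, periods, Matrix.fromRows_mul, Matrix.fromBlocks_map,
    Matrix.fromBlocks_mul_fromRows, h]
  simp

/-- Since `M` preserves `J`, the bilinear relation gives `Kᴴ (Im W) K = Im Z`. Inverting, `K` is an
isometry for the Hermitian forms `(Im W)⁻¹` and `(Im Z)⁻¹`. -/
theorem Rel.exists_normSq_eq {Z W : SiegelSpace k} (h : Rel Z W) :
    ∃ M ∈ Matrix.symplecticGroup (Fin k) ℤ, ∀ c : Fin k ⊕ Fin k → ℝ,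
      W.normSq c = Z.normSq (c ᵥ* M.map (Int.castRingHom ℝ)) := by
  obtain ⟨M, hM, K, hK⟩ := h.exists_mul_periods
  refine ⟨M, hM, fun c => ?_⟩
  have hMJ : (M.map (Int.castRingHom ℂ))ᴴ * Matrix.J (Fin k) ℂ * M.map (Int.castRingHom ℂ) =
      Matrix.J (Fin k) ℂ := by
    have h1 : (M.map (Int.castRingHom ℂ))ᴴ = (M.map (Int.castRingHom ℂ))ᵀ := by
      ext i j
      simp
    rw [h1]
    exact SymplecticGroup.mem_iff'.1 (SymplecticGroup.map_mem hM (Int.castRingHom ℂ))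
  have hY : Kᴴ * W.imPart * K = Z.imPart := by
    have h2 : Kᴴ * (W.periodsᴴ * Matrix.J (Fin k) ℂ * W.periods) * K =
        Z.periodsᴴ * Matrix.J (Fin k) ℂ * Z.periods := by
      calc _ = (W.periods * K)ᴴ * Matrix.J (Fin k) ℂ * (W.periods * K) := by
            simp only [Matrix.conjTranspose_mul, Matrix.mul_assoc]
        _ = Z.periodsᴴ * ((M.map (Int.castRingHom ℂ))ᴴ * Matrix.J (Fin k) ℂ *
            M.map (Int.castRingHom ℂ)) * Z.periods := by
            rw [hK]
            simp only [Matrix.conjTranspose_mul, Matrix.mul_assoc]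
        _ = _ := by rw [hMJ]
    rw [periods_conjTranspose_mul, periods_conjTranspose_mul, Matrix.mul_smul,
      Matrix.smul_mul] at h2
    exact smul_right_injective _ (by simp : (2 * Complex.I) ≠ 0) h2
  have hKdet : IsUnit K.det := by
    refine isUnit_iff_ne_zero.2 fun h0 => Z.det_imPart_ne_zero ?_
    rw [← hY, Matrix.det_mul, h0, mul_zero]
  have hinv : K * Z.imPart⁻¹ * Kᴴ = W.imPart⁻¹ := by
    have hKH : IsUnit Kᴴ.det := by
      rw [Matrix.det_conjTranspose]
      exact hKdet.star
    rw [← hY, Matrix.mul_inv_rev, Matrix.mul_inv_rev, ← Matrix.mul_assoc, ← Matrix.mul_assoc,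
      Matrix.mul_nonsing_inv _ hKdet, Matrix.one_mul, Matrix.mul_assoc,
      Matrix.nonsing_inv_mul _ hKH, Matrix.mul_one]
  have hvec : W.vec c ᵥ* K = Z.vec (c ᵥ* M.map (Int.castRingHom ℝ)) := by
    have hc : (fun i => ((c ᵥ* M.map (Int.castRingHom ℝ)) i : ℂ)) =
        (fun i => (c i : ℂ)) ᵥ* M.map (Int.castRingHom ℂ) := by
      ext i
      simp [Matrix.vecMul, dotProduct]
    rw [vec, vec, hc, Matrix.vecMul_vecMul, Matrix.vecMul_vecMul, hK]
  rw [normSq, normSq, ← hvec, Matrix.star_vecMul, ← hinv]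
  congr 1
  rw [← Matrix.dotProduct_mulVec, Matrix.mulVec_mulVec, Matrix.mulVec_mulVec, Matrix.mul_assoc]

/-- The lattice of `Z` contains `k` independent vectors of squared norm less than `ε`. -/
def HasShortVectors (ε : ℝ) (Z : SiegelSpace k) : Prop :=
  ∃ v : Fin k → Fin k ⊕ Fin k → ℤ, LinearIndependent ℝ (fun i j => (v i j : ℝ)) ∧
    ∀ i, Z.normSq (fun j => (v i j : ℝ)) < ε

/-- `M` permutes the integral vectors, because its determinant is a unit, and carries one norm to
the other. -/
theorem Rel.hasShortVectors_iff {Z W : SiegelSpace k} (h : Rel Z W) (ε : ℝ) :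
    Z.HasShortVectors ε ↔ W.HasShortVectors ε := by
  obtain ⟨M, hM, hnorm⟩ := h.exists_normSq_eq
  have hdet : IsUnit M.det := SymplecticGroup.symplectic_det hM
  have hcast : ∀ (N : Matrix (Fin k ⊕ Fin k) (Fin k ⊕ Fin k) ℤ) (v : Fin k ⊕ Fin k → ℤ),
      (fun j => ((v ᵥ* N) j : ℝ)) = (fun j => (v j : ℝ)) ᵥ* N.map (Int.castRingHom ℝ) := by
    intro N v
    ext j
    simp [Matrix.vecMul, dotProduct]
  have hind : ∀ (N : Matrix (Fin k ⊕ Fin k) (Fin k ⊕ Fin k) ℤ) (hN : IsUnit N.det)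
      (v : Fin k → Fin k ⊕ Fin k → ℤ), LinearIndependent ℝ (fun i j => (v i j : ℝ)) →
        LinearIndependent ℝ (fun i j => ((v i ᵥ* N) j : ℝ)) := by
    intro N hN v hv
    have heq : (fun i j => ((v i ᵥ* N) j : ℝ)) =
        fun i => (fun j => (v i j : ℝ)) ᵥ* N.map (Int.castRingHom ℝ) := funext fun i => hcast N (v i)
    rw [heq]
    have hinj : Function.Injective (N.map (Int.castRingHom ℝ)).vecMulLinear := by
      refine Matrix.vecMul_injective_of_isUnit ?_
      rw [Matrix.isUnit_iff_isUnit_det]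
      have : (N.map (Int.castRingHom ℝ)).det = Int.castRingHom ℝ N.det :=
        (RingHom.map_det _ _).symm
      rw [this]
      exact hN.map _
    exact hv.map' (N.map (Int.castRingHom ℝ)).vecMulLinear (LinearMap.ker_eq_bot.2 hinj)
  constructor
  · rintro ⟨v, hv, hlt⟩
    refine ⟨fun i => v i ᵥ* M⁻¹, hind _ (M.isUnit_nonsing_inv_det hdet) v hv, fun i => ?_⟩
    rw [hnorm, ← hcast, Matrix.vecMul_vecMul, Matrix.nonsing_inv_mul _ hdet, Matrix.vecMul_one]
    exact hlt i
  · rintro ⟨v, hv, hlt⟩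
    refine ⟨fun i => v i ᵥ* M, hind _ hdet v hv, fun i => ?_⟩
    rw [hcast, ← hnorm]
    exact hlt i

theorem continuous_normSq (c : Fin k ⊕ Fin k → ℝ) :
    Continuous fun Z : SiegelSpace k => Z.normSq c := by
  have hval : Continuous fun Z : SiegelSpace k => Z.1 := continuous_subtype_val
  have hentry : ∀ i j, Continuous fun Z : SiegelSpace k => Z.1 i j := fun i j =>
    (continuous_apply j).comp ((continuous_apply i).comp hval)
  have hY : Continuous fun Z : SiegelSpace k => Z.1.map Complex.im :=
    hval.matrix_map Complex.continuous_im
  have hinv : Continuous fun Z : SiegelSpace k => (Z.1.map Complex.im)⁻¹ := by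
    simp only [Matrix.inv_def, Ring.inverse_eq_inv']
    exact (hY.matrix_det.inv₀ det_im_ne_zero).smul hY.matrix_adjugate
  have hvec : ∀ j, Continuous fun Z : SiegelSpace k => Z.vec c j := fun j => by
    simp only [vec_apply]
    exact (continuous_finsetSum _ fun i _ => continuous_const.mul (hentry i j)).add
      continuous_const
  simp only [normSq_eq]
  have hre : Continuous fun (Z : SiegelSpace k) j => (Z.vec c j).re :=
    continuous_pi fun j => Complex.continuous_re.comp (hvec j)
  have him : Continuous fun (Z : SiegelSpace k) j => (Z.vec c j).im :=
    continuous_pi fun j => Complex.continuous_im.comp (hvec j)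
  exact (hre.dotProduct (hinv.matrix_mulVec hre)).add (him.dotProduct (hinv.matrix_mulVec him))

end SiegelSpace

/-! ### Inverse of a block matrix and the Schur complement -/

namespace Matrix

/-- Completion of the square for the inverse of a block matrix. -/
theorem dotProduct_inv_fromBlocks_mulVec_le {m n : Type*} [Fintype m] [Fintype n]
    [DecidableEq m] [DecidableEq n] {A : Matrix m m ℝ} {B : Matrix m n ℝ} {D : Matrix n n ℝ}
    (hA : A.PosDef) (hY : (fromBlocks A B Bᵀ D).PosDef) {c : ℝ} (hc : 0 < c)
    (hS : (D - Bᵀ * A⁻¹ * B - c • (1 : Matrix n n ℝ)).PosDef) (w₁ : m → ℝ) (w₂ : n → ℝ) :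
    Sum.elim w₁ w₂ ⬝ᵥ ((fromBlocks A B Bᵀ D)⁻¹ *ᵥ Sum.elim w₁ w₂) ≤
      w₁ ⬝ᵥ (A⁻¹ *ᵥ w₁) + ((w₂ - Bᵀ *ᵥ (A⁻¹ *ᵥ w₁)) ⬝ᵥ (w₂ - Bᵀ *ᵥ (A⁻¹ *ᵥ w₁))) / c := by
  have hYu : IsUnit (fromBlocks A B Bᵀ D).det := isUnit_iff_ne_zero.2 hY.det_pos.ne'
  have hAu : IsUnit A.det := isUnit_iff_ne_zero.2 hA.det_pos.ne'
  obtain ⟨z, hz⟩ : ∃ z, z = (fromBlocks A B Bᵀ D)⁻¹ *ᵥ Sum.elim w₁ w₂ := ⟨_, rfl⟩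
  obtain ⟨z₁, z₂, rfl⟩ : ∃ z₁ z₂, z = Sum.elim z₁ z₂ :=
    ⟨z ∘ Sum.inl, z ∘ Sum.inr, (Sum.elim_comp_inl_inr z).symm⟩
  have hw : fromBlocks A B Bᵀ D *ᵥ Sum.elim z₁ z₂ = Sum.elim w₁ w₂ := by
    rw [hz, mulVec_mulVec, mul_nonsing_inv _ hYu, one_mulVec]
  rw [fromBlocks_mulVec] at hw
  have h1 : A *ᵥ z₁ + B *ᵥ z₂ = w₁ := by
    simpa using congrArg (· ∘ Sum.inl) hw
  have h2 : Bᵀ *ᵥ z₁ + D *ᵥ z₂ = w₂ := by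
    simpa using congrArg (· ∘ Sum.inr) hw
  rw [← hz]
  set q := w₂ - Bᵀ *ᵥ (A⁻¹ *ᵥ w₁) with hq
  have hz1 : A⁻¹ *ᵥ w₁ = z₁ + A⁻¹ *ᵥ (B *ᵥ z₂) := by
    rw [← h1, mulVec_add, mulVec_mulVec, nonsing_inv_mul _ hAu, one_mulVec]
  -- Block elimination: the Schur complement maps `z₂` to the residual `q`, so the form splits as
  -- `w₁ ⬝ A⁻¹ w₁ + q ⬝ z₂`.
  have hSz : (D - Bᵀ * A⁻¹ * B) *ᵥ z₂ = q := by
    rw [hq, hz1, ← h2, sub_mulVec, mulVec_add, ← mulVec_mulVec, ← mulVec_mulVec]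
    abel
  have hAT : A⁻¹ᵀ = A⁻¹ := by
    have := hA.inv.1
    rwa [IsHermitian, conjTranspose_eq_transpose_of_trivial] at this
  have hdot : w₁ ⬝ᵥ z₁ + w₂ ⬝ᵥ z₂ = w₁ ⬝ᵥ (A⁻¹ *ᵥ w₁) + q ⬝ᵥ z₂ := by
    have h3 : (Bᵀ *ᵥ (A⁻¹ *ᵥ w₁)) ⬝ᵥ z₂ = w₁ ⬝ᵥ (A⁻¹ *ᵥ (B *ᵥ z₂)) := by
      rw [mulVec_transpose, ← dotProduct_mulVec, dotProduct_comm, dotProduct_mulVec,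
        ← mulVec_transpose, hAT, dotProduct_comm, dotProduct_mulVec, ← mulVec_transpose, hAT,
        dotProduct_comm, dotProduct_mulVec, ← mulVec_transpose, hAT, dotProduct_comm]
    rw [hq, sub_dotProduct, h3, hz1, dotProduct_add]
    ring
  rw [sumElim_dotProduct_sumElim, hdot]
  refine add_le_add_right ?_ _
  have hpos : c * (z₂ ⬝ᵥ z₂) ≤ z₂ ⬝ᵥ q := by
    have := hS.posSemidef.dotProduct_mulVec_nonneg z₂
    rw [star_trivial, sub_mulVec, hSz, smul_mulVec, one_mulVec, dotProduct_sub,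
      dotProduct_smul, smul_eq_mul] at this
    linarith
  clear_value q
  -- Together with `c |z₂|² ≤ q ⬝ z₂`, this square yields `q ⬝ z₂ ≤ |q|² / c`.
  have hsq : 0 ≤ (q - c • z₂) ⬝ᵥ (q - c • z₂) :=
    Finset.sum_nonneg fun i _ => mul_self_nonneg _
  rw [sub_dotProduct, dotProduct_sub, dotProduct_sub, dotProduct_smul, smul_dotProduct,
    smul_dotProduct, dotProduct_smul] at hsq
  simp only [smul_eq_mul] at hsq
  rw [dotProduct_comm z₂ q] at hpos hsq
  rw [le_div_iff₀ hc]
  nlinarith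

end Matrix

/-! ### Extending short vectors from the upper left block -/

namespace SiegelSpace

open Matrix

variable {k n : ℕ}

/-- Extension of a lattice vector of the upper left block. -/
def extend (v : Fin k ⊕ Fin k → ℝ) (t : Fin n → ℝ) : Fin (k + n) ⊕ Fin (k + n) → ℝ :=
  Sum.elim (Fin.append (v ∘ Sum.inl) 0) (Fin.append (v ∘ Sum.inr) t)

theorem vec_extend_castAdd (Z : SiegelSpace (k + n)) (v : Fin k ⊕ Fin k → ℝ) (t : Fin n → ℝ)
    (j : Fin k) : Z.vec (extend v t) (Fin.castAdd n j) = Z.topLeft.vec v j := by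
  rw [vec_apply, vec_apply]
  simp [extend, Fin.sum_univ_add, topLeft]

theorem vec_extend_natAdd (Z : SiegelSpace (k + n)) (v : Fin k ⊕ Fin k → ℝ) (t : Fin n → ℝ)
    (j : Fin n) : Z.vec (extend v t) (Fin.natAdd k j) =
      ∑ i, (v (Sum.inl i) : ℂ) * Z.1 (Fin.castAdd n i) (Fin.natAdd k j) + t j := by
  simp [vec_apply, extend, Fin.sum_univ_add]

theorem dotProduct_inv_mulVec_le (Z : SiegelSpace (k + n)) {c : ℝ} (hc : 0 < c)
    (hS : (Z.schur - c • (1 : Matrix (Fin n) (Fin n) ℝ)).PosDef) (x : Fin (k + n) → ℝ)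
    {q : Fin n → ℝ}
    (hq : q = (x ∘ Fin.natAdd k) - ((Z.1.map Complex.im).submatrix (Fin.castAdd n)
      (Fin.natAdd k))ᵀ *ᵥ ((Z.topLeft.1.map Complex.im)⁻¹ *ᵥ (x ∘ Fin.castAdd n))) :
    x ⬝ᵥ ((Z.1.map Complex.im)⁻¹ *ᵥ x) ≤ (x ∘ Fin.castAdd n) ⬝ᵥ
      ((Z.topLeft.1.map Complex.im)⁻¹ *ᵥ (x ∘ Fin.castAdd n)) + (q ⬝ᵥ q) / c := by
  set Y := Z.1.map Complex.im with hY
  have hYT : Yᵀ = Y := by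
    ext i j
    exact congrArg Complex.im (congrFun (congrFun Z.2.1 i) j)
  have hBT : Y.submatrix (Fin.natAdd k) (Fin.castAdd n) =
      (Y.submatrix (Fin.castAdd n) (Fin.natAdd k))ᵀ := by
    rw [transpose_submatrix, hYT]
  have hblock : Y.submatrix finSumFinEquiv finSumFinEquiv =
      fromBlocks (Z.topLeft.1.map Complex.im) (Y.submatrix (Fin.castAdd n) (Fin.natAdd k))
        (Y.submatrix (Fin.castAdd n) (Fin.natAdd k))ᵀ
        (Y.submatrix (Fin.natAdd k) (Fin.natAdd k)) := by
    rw [← hBT]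
    ext (i | i) (j | j) <;> simp [hY, topLeft]
  have hpos : (Y.submatrix (finSumFinEquiv (m := k) (n := n)) finSumFinEquiv).PosDef :=
    Z.2.2.submatrix finSumFinEquiv.injective
  rw [hblock] at hpos
  have hx : x ∘ finSumFinEquiv = Sum.elim (x ∘ Fin.castAdd n) (x ∘ Fin.natAdd k) := by
    ext (i | i) <;> simp
  have heq : x ⬝ᵥ (Y⁻¹ *ᵥ x) = (x ∘ finSumFinEquiv) ⬝ᵥ
      ((Y.submatrix finSumFinEquiv finSumFinEquiv)⁻¹ *ᵥ (x ∘ finSumFinEquiv)) := by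
    rw [inv_submatrix_equiv, submatrix_mulVec_equiv, Function.comp_assoc,
      Equiv.self_comp_symm, Function.comp_id]
    exact (comp_equiv_dotProduct_comp_equiv _ _ _).symm
  rw [heq, hblock, hx, hq]
  refine dotProduct_inv_fromBlocks_mulVec_le Z.topLeft.2.2 hpos hc ?_ _ _
  rw [schur, hBT] at hS
  exact hS

/-- The imaginary part of a lattice vector is `Im Z` applied to its first coordinates, so its
residual in the completed square vanishes. Only the real part contributes, and its offset `r` does
not depend on `t`, which leaves `t` free to cancel it up to rounding. -/
theorem normSq_extend_le (Z : SiegelSpace (k + n)) {c : ℝ} (hc : 0 < c)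
    (hS : (Z.schur - c • (1 : Matrix (Fin n) (Fin n) ℝ)).PosDef) (v : Fin k ⊕ Fin k → ℝ) :
    ∃ r : Fin n → ℝ, (v = 0 → r = 0) ∧ ∀ t : Fin n → ℝ,
      Z.normSq (extend v t) ≤ Z.topLeft.normSq v + ((t + r) ⬝ᵥ (t + r)) / c := by
  set B := (Z.1.map Complex.im).submatrix (Fin.castAdd n) (Fin.natAdd k) with hB
  set A := Z.topLeft.1.map Complex.im with hA
  refine ⟨(fun j => (∑ i, (v (Sum.inl i) : ℂ) * Z.1 (Fin.castAdd n i) (Fin.natAdd k j)).re) -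
    Bᵀ *ᵥ (A⁻¹ *ᵥ fun j => (Z.topLeft.vec v j).re), ?_, fun t => ?_⟩
  · rintro rfl
    have h0 : (fun j => (Z.topLeft.vec 0 j).re) = 0 := by
      ext j
      simp [vec_apply]
    rw [h0]
    ext j
    simp
  · rw [normSq_eq, normSq_eq]
    have hre := Z.dotProduct_inv_mulVec_le hc hS (fun j => (Z.vec (extend v t) j).re) rfl
    have him := Z.dotProduct_inv_mulVec_le hc hS (fun j => (Z.vec (extend v t) j).im) rfl
    have hAT : Aᵀ = A := by
      ext i j
      exact congrArg Complex.im (congrFun (congrFun Z.topLeft.2.1 i) j)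
    have him1 : (fun j => (Z.vec (extend v t) j).im) ∘ Fin.castAdd n =
        fun j => (Z.topLeft.vec v j).im := by
      ext j
      simp [vec_extend_castAdd]
    have hre1 : (fun j => (Z.vec (extend v t) j).re) ∘ Fin.castAdd n =
        fun j => (Z.topLeft.vec v j).re := by
      ext j
      simp [vec_extend_castAdd]
    have himA : (fun j => (Z.topLeft.vec v j).im) = A *ᵥ (v ∘ Sum.inl) := by
      rw [← hAT, mulVec_transpose]
      ext j
      simp [vec_apply, vecMul, dotProduct, hA]
    have him2 : (fun j => (Z.vec (extend v t) j).im) ∘ Fin.natAdd k = Bᵀ *ᵥ (v ∘ Sum.inl) := by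
      rw [mulVec_transpose]
      ext j
      simp [vec_extend_natAdd, vecMul, dotProduct, hB]
    have hre2 : (fun j => (Z.vec (extend v t) j).re) ∘ Fin.natAdd k = t +
        fun j => (∑ i, (v (Sum.inl i) : ℂ) * Z.1 (Fin.castAdd n i) (Fin.natAdd k j)).re := by
      ext j
      simp [vec_extend_natAdd, add_comm]
    rw [him1, him2, himA, ← hA, mulVec_mulVec,
      nonsing_inv_mul _ (isUnit_iff_ne_zero.2 Z.topLeft.det_im_ne_zero), one_mulVec, sub_self,
      zero_dotProduct, zero_div, add_zero] at him
    rw [hre1, hre2, add_sub_assoc, ← hA, ← hB] at hre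
    rw [himA, ← hA, mulVec_mulVec _ A⁻¹ A,
      nonsing_inv_mul _ (isUnit_iff_ne_zero.2 Z.topLeft.det_im_ne_zero), one_mulVec]
    linarith

/-- Short vectors of the upper left block extend to short vectors when the Schur complement is
large. -/
theorem HasShortVectors.of_topLeft {Z : SiegelSpace (k + n)} {c ε : ℝ} (hc : 0 < c)
    (hS : (Z.schur - c • (1 : Matrix (Fin n) (Fin n) ℝ)).PosDef) (hcε : 1 / c < ε)
    {v : Fin k → Fin k ⊕ Fin k → ℤ} (hv : LinearIndependent ℝ (fun i j => (v i j : ℝ)))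
    (hvε : ∀ i, Z.topLeft.normSq (fun j => (v i j : ℝ)) + n / c < ε) :
    Z.HasShortVectors ε := by
  let ext' : (Fin k ⊕ Fin k → ℤ) → (Fin n → ℤ) → Fin (k + n) ⊕ Fin (k + n) → ℤ := fun v t =>
    Sum.elim (Fin.append (v ∘ Sum.inl) 0) (Fin.append (v ∘ Sum.inr) t)
  have hext : ∀ v t, (fun j => (ext' v t j : ℝ)) =
      extend (fun j => (v j : ℝ)) (fun j => (t j : ℝ)) := by
    intro v t
    ext (j | j) <;> refine Fin.addCases (fun j => ?_) (fun j => ?_) j <;> simp [ext', extend]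
  choose r hr0 hr using fun v => Z.normSq_extend_le hc hS v
  -- With this choice `t + r` has entries in `[0, 1)`, which costs at most `n / c`.
  let t : Fin k → Fin n → ℤ := fun i j => -⌊r (fun j => (v i j : ℝ)) j⌋
  -- The `n` new vectors are the last `b`-generators; their offset is `0` and their squared norm at
  -- most `1 / c`. The resulting family is block triangular, hence independent.
  let u : Fin k ⊕ Fin n → Fin (k + n) ⊕ Fin (k + n) → ℤ :=
    Sum.elim (fun i => ext' (v i) (t i)) (fun j => ext' 0 (Pi.single j 1))
  have hu : ∀ i, Z.normSq (fun j => (u i j : ℝ)) < ε := by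
    rintro (i | i)
    · change Z.normSq (fun j => (ext' (v i) (t i) j : ℝ)) < ε
      rw [hext]
      refine lt_of_le_of_lt ((hr _ _).trans (add_le_add_right ?_ _)) (hvε i)
      refine div_le_div_of_nonneg_right ?_ hc.le
      refine (Finset.sum_le_card_nsmul _ _ 1 fun j _ => ?_).trans_eq (by simp)
      have h : ((t i j : ℤ) : ℝ) + r (fun j => (v i j : ℝ)) j =
          Int.fract (r (fun j => (v i j : ℝ)) j) := by
        simp only [t, Int.cast_neg, Int.fract]
        ring
      simp only [Pi.add_apply]
      rw [h]
      exact mul_le_one₀ (Int.fract_lt_one _).le (Int.fract_nonneg _) (Int.fract_lt_one _).le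
    · change Z.normSq (fun j => (ext' 0 (Pi.single i 1) j : ℝ)) < ε
      rw [hext]
      refine lt_of_le_of_lt (hr _ _) ?_
      have h0 : (fun j => (((0 : Fin k ⊕ Fin k → ℤ) j : ℤ) : ℝ)) = 0 := by
        ext j
        simp
      have h1 : (fun j => (((Pi.single i 1 : Fin n → ℤ) j : ℤ) : ℝ)) = Pi.single i 1 := by
        ext j
        by_cases h : j = i
        · subst h
          simp
        · simp [h]
      have h2 : Z.topLeft.normSq 0 = 0 := by
        have h3 : Z.topLeft.vec 0 = 0 := by
          ext j
          simp [vec_apply]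
        simp [normSq, h3]
      rw [h0, hr0 _ rfl, h1, h2]
      simpa using hcε
  have hind : LinearIndependent ℝ (fun i j => (u i j : ℝ)) := by
    rw [Fintype.linearIndependent_iff] at hv ⊢
    intro a ha
    rw [Fintype.sum_sum_type] at ha
    have hinl : ∀ i, a (Sum.inl i) = 0 := by
      refine hv (fun i => a (Sum.inl i)) ?_
      ext (j | j)
      · simpa [u, ext'] using congrFun ha (Sum.inl (Fin.castAdd n j))
      · simpa [u, ext'] using congrFun ha (Sum.inr (Fin.castAdd n j))
    rintro (i | i)
    · exact hinl i
    · have := congrFun ha (Sum.inr (Fin.natAdd k i))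
      simpa [u, ext', hinl, Pi.single_apply] using this
  exact ⟨fun i => u (finSumFinEquiv.symm i), hind.comp _ finSumFinEquiv.symm.injective,
    fun i => hu _⟩

end SiegelSpace

/-! ### Short vectors as an open condition in the Satake topology -/

namespace SatakeBB

variable {g : ℕ}

/-- The points of the compactification whose lattice has short Lagrangian vectors. -/
def shortVectorSet (g : ℕ) (ε : ℝ) : Set (SatakeBB g) :=
  {p | Quot.lift (SiegelSpace.HasShortVectors ε)
    (fun _ _ h => propext (h.hasShortVectors_iff ε)) p.point}

theorem isOpen_shortVectorSet {ε : ℝ} (hε : 0 < ε) : IsOpen (shortVectorSet g ε) := by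
  rintro k hk Z₀ ⟨v, hv, hlt⟩
  have hlim : ∀ᶠ c : ℝ in atTop, 0 < c ∧ 1 / c < ε ∧
      ∀ i, Z₀.normSq (fun j => (v i j : ℝ)) + g / c < ε := by
    refine (eventually_gt_atTop 0).and (((tendsto_const_nhds.div_atTop
      tendsto_id).eventually_lt_const hε).and (eventually_all.2 fun i => ?_))
    have h : Tendsto (fun c : ℝ => Z₀.normSq (fun j => (v i j : ℝ)) + g / c) atTop
        (𝓝 (Z₀.normSq (fun j => (v i j : ℝ)) + 0)) :=
      tendsto_const_nhds.add (tendsto_const_nhds.div_atTop tendsto_id)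
    rw [add_zero] at h
    exact h.eventually_lt_const (hlt i)
  obtain ⟨c, hc, hcε, hvc⟩ := hlim.exists
  -- Using `g / c` instead of `n / c` gives one neighbourhood that serves all `n ≤ g - k`.
  refine ⟨{Z | ∀ i, Z.normSq (fun j => (v i j : ℝ)) + g / c < ε}, ?_, c, hc, ?_⟩
  · refine eventually_all.2 fun i => ?_
    exact ((SiegelSpace.continuous_normSq _).add
      continuous_const).continuousAt.eventually_lt_const (hvc i)
  · intro n hn Z hZ hS
    refine SiegelSpace.HasShortVectors.of_topLeft hc hS hcε hv fun i => lt_of_le_of_lt ?_ (hZ i)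
    gcongr
    omega

theorem cusp_mem_shortVectorSet (ε : ℝ) : cusp g ∈ shortVectorSet g ε := by
  change SiegelSpace.HasShortVectors (k := 0) ε _
  exact ⟨Fin.elim0, linearIndependent_empty_type, fun i => i.elim0⟩

end SatakeBB

/-! ### From period matrices to the Hermitian metric -/

namespace PPAV

open Matrix

variable {g : ℕ} {V : PPAV g}

/-- The Gram matrix of the `b j` is real because `E(b, b) = 0`, and `E(aᵢ, bⱼ) = δᵢⱼ` says that it
is inverse to `Im Z`. This is why `normSq` is built on `(Im Z)⁻¹`. -/
theorem IsPeriodMatrix.exists_coordinates {Z : SiegelSpace g} (h : V.IsPeriodMatrix Z) :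
    ∃ f : (Fin g ⊕ Fin g → ℝ) →ₗ[ℝ] V.carrier, Function.Injective f ∧
      (∀ v : Fin g ⊕ Fin g → ℤ, f (fun j => (v j : ℝ)) ∈ V.lattice) ∧
      ∀ c, ‖f c‖ ^ 2 = Z.normSq c := by
  obtain ⟨a, b, hspan, -, hbb, hab, hZ⟩ := h
  let s : Fin g ⊕ Fin g → V.carrier := Sum.elim a b
  have hs : Submodule.span ℤ (Set.range s) = V.lattice := by
    rw [Set.Sum.elim_range, hspan]
  have hsR : ⊤ ≤ Submodule.span ℝ (Set.range s) := by
    rw [← IsZLattice.span_top (K := ℝ) (L := V.lattice), ← hs]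
    exact Submodule.span_le.2 (Submodule.span_subset_span ℤ ℝ _)
  have hind : LinearIndependent ℝ s := by
    refine linearIndependent_of_top_le_span_of_card_eq_finrank hsR ?_
    rw [V.finrank_real_carrier, Fintype.card_sum, Fintype.card_fin, two_mul]
  have hf : ∀ c, Fintype.linearCombination ℝ s c = ∑ j, Z.vec c j • b j := by
    intro c
    simp only [Fintype.linearCombination_apply, Fintype.sum_sum_type, s, Sum.elim_inl,
      Sum.elim_inr, hZ, SiegelSpace.vec_apply, add_smul, Finset.sum_add_distrib, Finset.sum_smul,
      Finset.smul_sum]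
    congr 1
    rw [Finset.sum_comm]
    refine Finset.sum_congr rfl fun j _ => Finset.sum_congr rfl fun i _ => ?_
    rw [mul_smul, Complex.coe_smul]
  refine ⟨Fintype.linearCombination ℝ s, ?_, fun v => ?_, fun c => ?_⟩
  · exact hind.fintypeLinearCombination_injective
  · rw [Fintype.linearCombination_apply, ← hs]
    refine Submodule.sum_mem _ fun j _ => ?_
    rw [Int.cast_smul_eq_zsmul]
    exact Submodule.smul_mem _ _ (Submodule.subset_span ⟨j, rfl⟩)
  · let G : Matrix (Fin g) (Fin g) ℂ := Matrix.of fun i j => inner ℂ (b j) (b i)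
    have hGim : ∀ i j, (G i j).im = 0 := fun i j => hbb i j
    have hG : Z.imPart * G = 1 := by
      ext i j
      have h1 := hab i j
      rw [form, hZ, inner_sum, Complex.im_sum] at h1
      simp only [inner_smul_right, Complex.mul_im] at h1
      have h2 : ∀ l, (inner ℂ (b j) (b l)).im = 0 := fun l => hGim l j
      simp only [h2, mul_zero, zero_add] at h1
      rw [Matrix.mul_apply]
      apply Complex.ext
      · rw [Complex.re_sum]
        simp only [SiegelSpace.imPart, Matrix.map_apply, Complex.ofRealHom_eq_coe,
          Complex.re_ofReal_mul, G, Matrix.of_apply, h1, Matrix.one_apply]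
        split_ifs <;> simp
      · rw [Complex.im_sum]
        simp only [SiegelSpace.imPart, Matrix.map_apply, Complex.ofRealHom_eq_coe,
          Complex.im_ofReal_mul, hGim, mul_zero, Finset.sum_const_zero, Matrix.one_apply]
        split_ifs <;> simp
    rw [SiegelSpace.normSq, Matrix.inv_eq_right_inv hG, hf, ← inner_self_eq_norm_sq (𝕜 := ℂ),
      inner_sum]
    simp only [sum_inner, inner_smul_left, inner_smul_right, dotProduct, Matrix.mulVec, G,
      Matrix.of_apply, Pi.star_apply, RCLike.star_def, RCLike.re_to_complex]
    congr 1
    refine Finset.sum_congr rfl fun i _ => ?_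
    rw [Finset.mul_sum, Finset.mul_sum]
    exact Finset.sum_congr rfl fun j _ => by ring

end PPAV

/-- Close to the cusp, there are `g` independent short lattice vectors. -/
theorem ConvergesToCusp.eventually_short {g : ℕ} {V : ℕ → PPAV g} (h : ConvergesToCusp V)
    {ε : ℝ} (hε : 0 < ε) : ∀ᶠ i in atTop, ∃ w : Fin g → (V i).carrier,
      LinearIndependent ℝ w ∧ ∀ j, w j ∈ (V i).lattice ∧ ‖w j‖ < ε := by
  obtain ⟨Z, hZ, hlim⟩ := h
  have hε2 : 0 < ε ^ 2 := by positivity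
  filter_upwards [hlim.eventually ((SatakeBB.isOpen_shortVectorSet hε2).mem_nhds
    (SatakeBB.cusp_mem_shortVectorSet (ε ^ 2)))] with i hi
  obtain ⟨v, hv, hlt⟩ : (Z i).HasShortVectors (ε ^ 2) := hi
  obtain ⟨f, hf, hmem, hnorm⟩ := (hZ i).exists_coordinates
  refine ⟨fun j => f (fun l => (v j l : ℝ)), hv.map' f (LinearMap.ker_eq_bot.2 hf),
    fun j => ⟨hmem _, ?_⟩⟩
  refine lt_of_pow_lt_pow_left₀ 2 hε.le ?_
  rw [hnorm]
  exact hlt j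

/-! ### Abelian varieties with prescribed symplectic bases -/

namespace PPAV

variable {g : ℕ}

theorem exists_of_symplectic {W : Type} [NormedAddCommGroup W] [InnerProductSpace ℂ W]
    [FiniteDimensional ℂ W] (hW : Module.finrank ℂ W = g) (a b : Fin g → W)
    (haa : ∀ i j, (inner ℂ (a j) (a i)).im = 0) (hbb : ∀ i j, (inner ℂ (b j) (b i)).im = 0)
    (hab : ∀ i j, (inner ℂ (b j) (a i)).im = if i = j then 1 else 0) :
    ∃ (V : PPAV g) (u : W ≃ₗᵢ[ℂ] V.carrier),
      (∀ x, u x ∈ V.lattice ↔ x ∈ Submodule.span ℤ (Set.range a ∪ Set.range b)) ∧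
      ∀ Z : SiegelSpace g, (∀ i, a i = ∑ j, Z.1 i j • b j) → V.IsPeriodMatrix Z := by
  have hba : ∀ i j, (inner ℂ (a i) (b j)).im = if i = j then -1 else 0 := fun i j => by
    rw [← inner_conj_symm, Complex.conj_im, hab]
    split_ifs <;> simp
  let s : Fin g ⊕ Fin g → W := Sum.elim a b
  have hind : LinearIndependent ℝ s := by
    rw [Fintype.linearIndependent_iff]
    intro c hc
    rw [Fintype.sum_sum_type] at hc
    simp only [s, Sum.elim_inl, Sum.elim_inr, ← Complex.coe_smul] at hc
    rintro (l | l)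
    -- Pairing with `b l` isolates the coefficient of `a l`, and conversely.
    · have h := congrArg (fun x => (inner ℂ (b l) x).im) hc
      simpa [inner_add_right, inner_sum, inner_smul_right, hab, hbb] using h
    · have h := congrArg (fun x => (inner ℂ (a l) x).im) hc
      simpa [inner_add_right, inner_sum, inner_smul_right, hba, haa] using h
  have hcard : Fintype.card (Fin g ⊕ Fin g) = Module.finrank ℝ W := by
    rw [finrank_real_of_complex, hW, Fintype.card_sum, Fintype.card_fin, two_mul]
  let β : Module.Basis (Fin g ⊕ Fin g) ℝ W := Module.Basis.mk hind
    (hind.span_eq_top_of_card_eq_finrank' hcard).ge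
  have hβ : Set.range β = Set.range a ∪ Set.range b := by
    rw [Module.Basis.coe_mk, Set.Sum.elim_range]
  have hsmulr : ∀ (n : ℤ) (x y : W), (inner ℂ x (n • y)).im = n * (inner ℂ x y).im := by
    intro n x y
    rw [← Int.cast_smul_eq_zsmul ℂ, inner_smul_right]
    simp
  have hsmull : ∀ (n : ℤ) (x y : W), (inner ℂ (n • x) y).im = n * (inner ℂ x y).im := by
    intro n x y
    rw [← Int.cast_smul_eq_zsmul ℂ, inner_smul_left]
    simp
  have hint : ∀ x ∈ Submodule.span ℤ (Set.range β), ∀ y ∈ Submodule.span ℤ (Set.range β),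
      ∃ m : ℤ, (inner ℂ y x).im = m := by
    have hadd : ∀ x y : ℝ, (∃ m : ℤ, x = m) → (∃ m : ℤ, y = m) → ∃ m : ℤ, x + y = m := by
      rintro _ _ ⟨m, rfl⟩ ⟨n, rfl⟩
      exact ⟨m + n, by push_cast; rfl⟩
    have hmul : ∀ (n : ℤ) (x : ℝ), (∃ m : ℤ, x = m) → ∃ m : ℤ, n * x = m := by
      rintro n _ ⟨m, rfl⟩
      exact ⟨n * m, by push_cast; rfl⟩
    rw [hβ]
    intro x hx y hy
    induction hx using Submodule.span_induction with
    | mem x hx =>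
      induction hy using Submodule.span_induction with
      | mem y hy =>
        rcases hx with ⟨i, rfl⟩ | ⟨i, rfl⟩ <;> rcases hy with ⟨j, rfl⟩ | ⟨j, rfl⟩
        · exact ⟨0, by simp [haa]⟩
        · exact ⟨if i = j then 1 else 0, by simp [hab]⟩
        · exact ⟨if j = i then -1 else 0, by simp [hba]⟩
        · exact ⟨0, by simp [hbb]⟩
      | zero => exact ⟨0, by simp⟩
      | add y z _ _ hy hz =>
        rw [inner_add_left, Complex.add_im]
        exact hadd _ _ hy hz
      | smul n y _ hy =>
        rw [hsmull]
        exact hmul n _ hy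
    | zero => exact ⟨0, by simp⟩
    | add x z _ _ hx hz =>
      rw [inner_add_right, Complex.add_im]
      exact hadd _ _ hx hz
    | smul n x _ hx =>
      rw [hsmulr]
      exact hmul n _ hx
  have hmema : ∀ i, a i ∈ Submodule.span ℤ (Set.range β) := fun i =>
    Submodule.subset_span (hβ ▸ Or.inl ⟨i, rfl⟩)
  have hmemb : ∀ i, b i ∈ Submodule.span ℤ (Set.range β) := fun i =>
    Submodule.subset_span (hβ ▸ Or.inr ⟨i, rfl⟩)
  have huni : ∀ φ : Submodule.span ℤ (Set.range β) →ₗ[ℤ] ℤ,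
      ∃ x ∈ Submodule.span ℤ (Set.range β), ∀ y : Submodule.span ℤ (Set.range β),
        (inner ℂ (y : W) x).im = φ y := by
    intro φ
    -- The symplectic dual of `φ`; the minus sign comes from `E(b, a) = -E(a, b)`.
    refine ⟨∑ i, φ ⟨b i, hmemb i⟩ • a i - ∑ i, φ ⟨a i, hmema i⟩ • b i,
      Submodule.sub_mem _ (Submodule.sum_mem _ fun i _ => Submodule.smul_mem _ _ (hmema i))
        (Submodule.sum_mem _ fun i _ => Submodule.smul_mem _ _ (hmemb i)), ?_⟩
    rintro ⟨y, hy⟩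
    simp only
    induction hy using Submodule.span_induction with
    | mem y hy =>
      rw [inner_sub_right, inner_sum, inner_sum]
      simp only [hsmulr, Complex.sub_im, Complex.im_sum]
      have hy' := hy
      rw [hβ] at hy'
      rcases hy' with ⟨i, rfl⟩ | ⟨i, rfl⟩
      · simp [haa, hba]
      · simp [hab, hbb]
    | zero =>
      rw [show (⟨0, Submodule.zero_mem _⟩ : Submodule.span ℤ (Set.range β)) = 0 from rfl]
      simp
    | add y z hy hz hy' hz' =>
      rw [inner_add_left, Complex.add_im, hy', hz', ← Int.cast_add, ← map_add]
      rfl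
    | smul n y hy hy' =>
      rw [hsmull, hy', ← Int.cast_mul, ← smul_eq_mul, ← map_smul]
      rfl
  refine ⟨{ carrier := W, finrank_eq := hW, lattice := Submodule.span ℤ (Set.range β),
            integral := hint, unimodular := huni }, LinearIsometryEquiv.refl ℂ W, fun x => ?_,
    fun Z hZ => ⟨a, b, ?_, haa, hbb, hab, hZ⟩⟩
  · rw [← hβ]
    rfl
  · rw [← hβ]

end PPAV

/-! ### Varieties with purely imaginary period matrix -/

namespace PPAV

open Matrix

variable {g : ℕ} {ι : Type} [Fintype ι] [DecidableEq ι]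

/-- The abelian variety with period matrix `i B Bᵀ`, whose lattice in `ℂ^ι` is spanned by the rows
of `B` in the real directions and by the columns of `B⁻¹` in the imaginary directions. -/
theorem exists_of_matrix (e : Fin g ≃ ι) {B C : Matrix ι ι ℝ} (hBC : B * C = 1) :
    ∃ (V : PPAV g) (u : EuclideanSpace ℂ ι ≃ₗᵢ[ℂ] V.carrier),
      (∀ x, u x ∈ V.lattice ↔ ∃ m n : ι → ℤ, ∀ l,
        (x l).re = ∑ j, m j * B j l ∧ (x l).im = ∑ j, n j * C l j) ∧
      ∃ Z : SiegelSpace g, Z.1.map Complex.im = (B * Bᵀ).submatrix e e ∧ V.IsPeriodMatrix Z := by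
  have hCB : C * B = 1 := mul_eq_one_comm.1 hBC
  let a : Fin g → EuclideanSpace ℂ ι := fun i => WithLp.toLp 2 fun l => (B (e i) l : ℂ)
  -- The factor `-i` makes `E(aᵢ, bⱼ)` equal to `+(B C)ᵢⱼ = δᵢⱼ`; it also causes the sign changes of
  -- `n` below.
  let b : Fin g → EuclideanSpace ℂ ι := fun j => WithLp.toLp 2 fun l => -Complex.I * C l (e j)
  have hab : ∀ i j, (inner ℂ (b j) (a i)).im = if i = j then 1 else 0 := by
    intro i j
    have h := congrFun (congrFun hBC (e i)) (e j)
    rw [Matrix.mul_apply, Matrix.one_apply] at h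
    simp only [e.injective.eq_iff] at h
    rw [PiLp.inner_apply, Complex.im_sum, ← h]
    exact Finset.sum_congr rfl fun l _ => by simp [a, b]
  obtain ⟨V, u, hu, hZ⟩ := exists_of_symplectic (by simp [← Fintype.card_congr e]) a b
    (fun i j => by
      rw [PiLp.inner_apply, Complex.im_sum]
      exact Finset.sum_eq_zero fun l _ => by simp [a])
    (fun i j => by
      rw [PiLp.inner_apply, Complex.im_sum]
      exact Finset.sum_eq_zero fun l _ => by simp [b])
    hab
  refine ⟨V, u, fun x => ?_, ?_⟩
  · rw [hu]
    have hcomb : ∀ (m n : ι → ℤ) l, (∑ i, m (e i) • a i + ∑ i, (-n (e i)) • b i) l =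
        (∑ j, m j * B j l : ℝ) + (∑ j, n j * C l j : ℝ) * Complex.I := by
      intro m n l
      rw [← e.sum_comp, ← e.sum_comp]
      simp only [PiLp.add_apply, WithLp.ofLp_sum, Finset.sum_apply, PiLp.smul_apply, a, b,
        zsmul_eq_mul]
      push_cast
      rw [Finset.sum_mul]
      congr 1
      exact Finset.sum_congr rfl fun i _ => by ring
    constructor
    · intro hx
      rw [Submodule.span_union, Submodule.mem_sup] at hx
      obtain ⟨y, hy, z, hz, rfl⟩ := hx
      obtain ⟨m, rfl⟩ := (Submodule.mem_span_range_iff_exists_fun ℤ).1 hy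
      obtain ⟨n, rfl⟩ := (Submodule.mem_span_range_iff_exists_fun ℤ).1 hz
      refine ⟨m ∘ e.symm, fun i => -n (e.symm i), fun l => ?_⟩
      have h := hcomb (m ∘ e.symm) (fun i => -n (e.symm i)) l
      simp only [Function.comp_apply, Equiv.symm_apply_apply, neg_neg] at h
      rw [h]
      constructor <;> simp
    · rintro ⟨m, n, h⟩
      have hx : x = ∑ i, m (e i) • a i + ∑ i, (-n (e i)) • b i := by
        ext l
        rw [hcomb, ← (h l).1, ← (h l).2, Complex.re_add_im]
      rw [hx]
      refine Submodule.add_mem _ (Submodule.sum_mem _ fun i _ => Submodule.smul_mem _ _ ?_)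
        (Submodule.sum_mem _ fun i _ => Submodule.smul_mem _ _ ?_)
      · exact Submodule.subset_span (Or.inl ⟨i, rfl⟩)
      · exact Submodule.subset_span (Or.inr ⟨i, rfl⟩)
  · have hpos : (B * Bᵀ).PosDef := by
      rw [← conjTranspose_eq_transpose_of_trivial]
      refine PosDef.mul_conjTranspose_self B (Function.LeftInverse.injective (g := (· ᵥ* C)) ?_)
      intro x
      simp only [vecMul_vecMul, hBC, vecMul_one]
    have him : ((Complex.I • (B * Bᵀ).map Complex.ofRealHom).submatrix e e).map Complex.im =
        (B * Bᵀ).submatrix e e := by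
      ext i j
      simp [-Matrix.map_mul]
    refine ⟨⟨(Complex.I • (B * Bᵀ).map Complex.ofRealHom).submatrix e e, ?_, ?_⟩, him, ?_⟩
    · ext i j
      have h : (B * Bᵀ) (e j) (e i) = (B * Bᵀ) (e i) (e j) := by
        simp only [Matrix.mul_apply, Matrix.transpose_apply]
        exact Finset.sum_congr rfl fun l _ => mul_comm _ _
      simp [-Matrix.map_mul, h]
    · rw [him]
      exact hpos.submatrix e.injective
    · refine hZ _ fun i => ?_
      ext l
      -- The relation `a = Z b` amounts to `B Bᵀ Cᵀ = B`, as `i · (-i) = 1`.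
      have h : B (e i) l = ∑ j, (B * Bᵀ) (e i) (e j) * C l (e j) := by
        rw [e.sum_comp fun j => (B * Bᵀ) (e i) j * C l j]
        have h1 : B * Bᵀ * Cᵀ = B := by
          rw [Matrix.mul_assoc, ← Matrix.transpose_mul, hCB, Matrix.transpose_one, Matrix.mul_one]
        conv_lhs => rw [← h1]
        rfl
      simp only [WithLp.ofLp_sum, Finset.sum_apply, PiLp.smul_apply, a, b, Matrix.submatrix_apply,
        Matrix.smul_apply, Matrix.map_apply, Complex.ofRealHom_eq_coe, smul_eq_mul]
      rw [h]
      push_cast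
      refine Finset.sum_congr rfl fun j _ => ?_
      linear_combination (((B * Bᵀ) (e i) (e j) : ℂ) * C l (e j)) * Complex.I_mul_I

end PPAV

open Matrix in
/-- A matrix `B Bᵀ` is large when `B⁻¹` is small. -/
theorem Matrix.posDef_mul_transpose_sub {ι : Type*} [Fintype ι] [DecidableEq ι]
    {B C : Matrix ι ι ℝ} (hBC : B * C = 1) {c : ℝ} (hc : 0 < c)
    (hsmall : c * ∑ i, ∑ j, C i j ^ 2 < 1) : (B * Bᵀ - c • (1 : Matrix ι ι ℝ)).PosDef := by
  refine Matrix.PosDef.of_dotProduct_mulVec_pos ?_ fun x hx => ?_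
  · rw [Matrix.IsHermitian, Matrix.conjTranspose_eq_transpose_of_trivial]
    simp
  · rw [star_trivial, Matrix.sub_mulVec, dotProduct_sub, sub_pos, Matrix.smul_mulVec,
      Matrix.one_mulVec, dotProduct_smul, smul_eq_mul, ← Matrix.mulVec_mulVec,
      Matrix.dotProduct_mulVec, ← Matrix.mulVec_transpose]
    set y := Bᵀ *ᵥ x with hy
    -- Hence `|x|²` is at most the squared Frobenius norm of `C` times `|Bᵀ x|²`.
    have hxy : x = Cᵀ *ᵥ y := by
      rw [hy, Matrix.mulVec_mulVec, ← Matrix.transpose_mul, hBC, Matrix.transpose_one,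
        Matrix.one_mulVec]
    have hy0 : 0 < y ⬝ᵥ y := by
      refine lt_of_le_of_ne (Finset.sum_nonneg fun i _ => mul_self_nonneg _) fun h => hx ?_
      rw [hxy, dotProduct_self_eq_zero.1 h.symm, Matrix.mulVec_zero]
    have hle : x ⬝ᵥ x ≤ (∑ i, ∑ j, C i j ^ 2) * (y ⬝ᵥ y) := by
      rw [Finset.sum_comm, Finset.sum_mul]
      refine Finset.sum_le_sum fun j _ => ?_
      have h := Finset.sum_mul_sq_le_sq_mul_sq Finset.univ (fun i => C i j) y
      have h1 : x j = ∑ i, C i j * y i := by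
        conv_lhs => rw [hxy]
        rfl
      rw [h1, ← sq]
      simpa [dotProduct, ← sq] using h
    calc c * (x ⬝ᵥ x) ≤ c * ((∑ i, ∑ j, C i j ^ 2) * (y ⬝ᵥ y)) :=
          mul_le_mul_of_nonneg_left hle hc.le
      _ = (c * ∑ i, ∑ j, C i j ^ 2) * (y ⬝ᵥ y) := by ring
      _ < 1 * (y ⬝ᵥ y) := mul_lt_mul_of_pos_right hsmall hy0
      _ = y ⬝ᵥ y := one_mul _

/-! ### A criterion for convergence to the cusp -/

/-- Transport of a point of the Siegel space along an equality of dimensions. -/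
def SiegelSpace.cast {m g : ℕ} (h : m = g) (Z : SiegelSpace g) : SiegelSpace m :=
  ⟨Z.1.submatrix (Fin.cast h) (Fin.cast h), Z.2.1.submatrix _,
    Z.2.2.submatrix (Fin.cast_injective h)⟩

/-- Neighbourhoods of the cusp are described by points of `ℍ_{0 + g}`, and `0 + g` is not
definitionally `g`. -/
theorem SatakeBB.ofSiegel_cast {m g : ℕ} (h : m = g) (Z : SiegelSpace g) :
    ofSiegel m h.le (Z.cast h) = ofSiegel g le_rfl Z := by
  subst h
  rfl

theorem SiegelSpace.schur_cast {g : ℕ} (Z : SiegelSpace g) :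
    (Z.cast (Nat.zero_add g)).schur = Z.1.map Complex.im := by
  ext a b
  simp only [schur, Matrix.sub_apply, Matrix.mul_apply, Finset.univ_eq_empty, Finset.sum_empty,
    sub_zero, cast, Matrix.submatrix_apply, Matrix.map_apply]
  exact congrArg Complex.im (congrArg₂ Z.1 (Fin.ext (by simp)) (Fin.ext (by simp)))

/-- At the cusp the upper left block is the single point of `ℍ_0` and the Schur complement is all of
`Im Z`, so only the growth condition remains. -/
theorem SatakeBB.tendsto_cusp {g : ℕ} (Z : ℕ → SiegelSpace g)
    (hZ : ∀ c : ℝ, 0 < c → ∀ᶠ i in atTop,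
      ((Z i).1.map Complex.im - c • (1 : Matrix (Fin g) (Fin g) ℝ)).PosDef) :
    Tendsto (fun i => ofSiegel g le_rfl (Z i)) atTop (𝓝 (cusp g)) := by
  rw [tendsto_nhds]
  intro W hW hcusp
  obtain ⟨U, hU, c, hc, H⟩ := hW 0 (Nat.zero_le g) _ hcusp
  filter_upwards [hZ c hc] with i hi
  change ofSiegel g le_rfl (Z i) ∈ W
  rw [← ofSiegel_cast (Nat.zero_add g)]
  refine H g _ _ ?_ ?_
  · have hsub : ∀ a b : SiegelSpace 0, a = b := fun a b => Subtype.ext (Subsingleton.elim _ _)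
    rw [hsub (SiegelSpace.topLeft _) _]
    exact mem_of_mem_nhds hU
  · rw [SiegelSpace.schur_cast]
    exact hi

/-! ### Collapsing families -/

/-- If, up to an error `δ i = o(σ i)`, the distance on `V i` is `σ i` times the pullback of the
distance of a flat torus `T`, then the normalized varieties converge to `T`. -/
theorem PPAV.tendsto_toNormalizedGH {g : ℕ} {W : Type} [NormedAddCommGroup W]
    [InnerProductSpace ℂ W] [FiniteDimensional ℂ W] (V : ℕ → PPAV g)
    (u : ∀ i, W ≃ₗᵢ[ℂ] (V i).carrier) {d : ℕ} (T : FlatTorus d) (hT : T.diam = 1)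
    (π : W →ₗ[ℝ] EuclideanSpace ℝ (Fin d)) (hπ : ∀ y, ∃ x, π x = y ∧ ‖x‖ ≤ ‖y‖)
    (σ δ : ℕ → ℝ) (hσ : ∀ i, 0 < σ i) (hδ : Tendsto (fun i => δ i / σ i) atTop (𝓝 0))
    (h : ∀ i x, |‖(Submodule.Quotient.mk (u i ((σ i : ℂ) • x)) : (V i).Space)‖ -
      σ i * ‖(Submodule.Quotient.mk (π x) : T.Space)‖| ≤ δ i) :
    Tendsto (fun i => (V i).toNormalizedGH) atTop (𝓝 T.toGH) := by
  have := FiniteDimensional.proper_rclike ℂ W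
  set D : ℕ → ℝ := fun i => Metric.diam (Set.univ : Set (V i).Space) with hDdef
  have hTle : ∀ z : T.Space, ‖z‖ ≤ 1 := fun z => (norm_le_diam_univ z).trans_eq hT
  -- Diameters are maxima of norms, and `T` has diameter `1`, so `D i` differs from `σ i` by at most
  -- `δ i`.
  have hD : ∀ i, |D i / σ i - 1| ≤ δ i / σ i := by
    intro i
    have hσi := hσ i
    have hupper : D i ≤ σ i + δ i := by
      obtain ⟨p, hp⟩ := exists_norm_eq_diam_univ (V i).Space
      obtain ⟨v, rfl⟩ := Submodule.Quotient.mk_surjective _ p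
      obtain ⟨x, rfl⟩ : ∃ x, u i ((σ i : ℂ) • x) = v := by
        refine ⟨(σ i : ℂ)⁻¹ • (u i).symm v, ?_⟩
        rw [smul_inv_smul₀ (by exact_mod_cast hσi.ne'), LinearIsometryEquiv.apply_symm_apply]
      have h1 := (abs_le.1 (h i x)).2
      have h2 := hTle (Submodule.Quotient.mk (π x))
      rw [hp] at h1
      change D i - _ ≤ _ at h1
      nlinarith
    have hlower : σ i - δ i ≤ D i := by
      obtain ⟨p, hp⟩ := exists_norm_eq_diam_univ T.Space
      obtain ⟨y, rfl⟩ := Submodule.Quotient.mk_surjective _ p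
      obtain ⟨x, rfl, -⟩ := hπ y
      have h1 := (abs_le.1 (h i x)).1
      have h2 := norm_le_diam_univ (Submodule.Quotient.mk (u i ((σ i : ℂ) • x)) : (V i).Space)
      rw [hp.trans hT] at h1
      change _ ≤ D i at h2
      linarith
    rw [div_sub_one hσi.ne', abs_div, abs_of_pos hσi]
    exact div_le_div_of_nonneg_right (abs_le.2 ⟨by linarith, by linarith⟩) hσi.le
  have hD1 : Tendsto (fun i => D i / σ i) atTop (𝓝 1) := by
    rw [tendsto_iff_norm_sub_tendsto_zero]
    exact squeeze_zero (fun i => norm_nonneg _) hD hδ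
  have hDpos : ∀ᶠ i in atTop, 0 < D i ∧ σ i ≤ 2 * D i ∧ D i ≤ 2 * σ i := by
    filter_upwards [hD1.eventually_const_lt (show (1 / 2 : ℝ) < 1 by norm_num),
      hD1.eventually_lt_const (show (1 : ℝ) < 2 by norm_num)] with i h1 h2
    have hσi := hσ i
    rw [lt_div_iff₀ hσi] at h1
    rw [div_lt_iff₀ hσi] at h2
    exact ⟨by linarith, by linarith, by linarith⟩
  let p : ∀ i, W → Rescaled (V i).Space (unitScale (V i).Space) := fun i x =>
    (Submodule.Quotient.mk (u i ((σ i : ℂ) • x)) : (V i).Space)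
  have hdist : ∀ i, 0 < D i → ∀ x y, dist (p i x) (p i y) =
      (D i)⁻¹ * ‖(Submodule.Quotient.mk (u i ((σ i : ℂ) • (x - y))) : (V i).Space)‖ := by
    intro i hi x y
    have h1 : dist (p i x) (p i y) = (unitScale (V i).Space).1 *
        dist (Submodule.Quotient.mk (u i ((σ i : ℂ) • x)) : (V i).Space)
          (Submodule.Quotient.mk (u i ((σ i : ℂ) • y))) := rfl
    rw [h1, unitScale_val hi, dist_eq_norm, ← Submodule.Quotient.mk_sub,
      ← map_sub, ← smul_sub]
  -- Eventually `σ ≤ 2 D` bounds the Lipschitz constant by `2`, and `D ≤ 2 σ` gives each point a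
  -- representative of norm below `D + σ ≤ 3 σ`, whence the radius `3`.
  refine tendsto_toGHSpace_of_tendsto_dist (isCompact_closedBall (0 : W) 3).totallyBounded
    p (fun x => (Submodule.Quotient.mk (π x) : T.Space)) 2 ?_ ?_ ?_ ?_
  · filter_upwards [hDpos] with i ⟨h0, h1, h2⟩
    refine LipschitzWith.of_dist_le_mul fun x y => ?_
    rw [hdist i h0, inv_mul_le_iff₀ h0]
    refine (Submodule.Quotient.norm_mk_le _ _).trans ?_
    rw [LinearIsometryEquiv.norm_map, norm_smul, Complex.norm_of_nonneg (hσ i).le, dist_eq_norm]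
    push_cast
    nlinarith [norm_nonneg (x - y)]
  · filter_upwards [hDpos] with i ⟨h0, h1, h2⟩
    intro (z : (V i).Space)
    obtain ⟨v, hv, hlt⟩ := Submodule.Quotient.norm_mk_lt (S := (V i).lattice) z (hσ i)
    have hσ0 : (σ i : ℂ) ≠ 0 := by exact_mod_cast (hσ i).ne'
    refine ⟨(σ i : ℂ)⁻¹ • (u i).symm v, ?_, ?_⟩
    · rw [mem_closedBall_zero_iff, norm_smul, LinearIsometryEquiv.norm_map, norm_inv,
        Complex.norm_of_nonneg (hσ i).le, inv_mul_le_iff₀ (hσ i)]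
      have h3 : ‖z‖ ≤ D i := norm_le_diam_univ z
      linarith
    · change (Submodule.Quotient.mk (u i ((σ i : ℂ) • ((σ i : ℂ)⁻¹ • (u i).symm v))) :
        (V i).Space) = z
      rw [smul_inv_smul₀ hσ0, LinearIsometryEquiv.apply_symm_apply]
      exact hv
  · intro z
    obtain ⟨y, rfl, hy⟩ := Submodule.Quotient.norm_mk_lt z one_pos
    obtain ⟨x, rfl, hx⟩ := hπ y
    refine ⟨x, ?_, rfl⟩
    rw [mem_closedBall_zero_iff]
    linarith [hTle (Submodule.Quotient.mk (π x))]
  · intro x y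
    set z := x - y with hz
    have hlim : Tendsto (fun i => (D i / σ i)⁻¹ *
        (‖(Submodule.Quotient.mk (u i ((σ i : ℂ) • z)) : (V i).Space)‖ / σ i)) atTop
        (𝓝 (1⁻¹ * ‖(Submodule.Quotient.mk (π z) : T.Space)‖)) := by
      refine (hD1.inv₀ one_ne_zero).mul ?_
      rw [tendsto_iff_norm_sub_tendsto_zero]
      refine squeeze_zero (fun i => norm_nonneg _) (fun i => ?_) hδ
      rw [Real.norm_eq_abs, div_sub' (hσ i).ne', abs_div, abs_of_pos (hσ i)]
      exact div_le_div_of_nonneg_right (h i z) (hσ i).le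
    rw [inv_one, one_mul] at hlim
    rw [dist_eq_norm, ← Submodule.Quotient.mk_sub, ← map_sub, ← hz]
    refine hlim.congr' ?_
    filter_upwards [hDpos] with i hi
    have hσi := (hσ i).ne'
    have hDi := hi.1.ne'
    rw [hdist i hi.1, ← hz]
    field_simp

theorem FlatTorus.exists_matrix {n : ℕ} (T : FlatTorus n) :
    ∃ B C : Matrix (Fin n) (Fin n) ℝ, B * C = 1 ∧
      ∀ y, y ∈ T.lattice ↔ ∃ m : Fin n → ℤ, ∀ l, y l = ∑ j, m j * B j l := by
  have : Module.Free ℤ T.lattice := ZLattice.module_free ℝ T.lattice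
  have : Module.Finite ℤ T.lattice := ZLattice.module_finite ℝ T.lattice
  have hrank : Module.finrank ℤ T.lattice = n := by
    rw [ZLattice.rank ℝ T.lattice, finrank_euclideanSpace_fin]
  let b := Module.finBasisOfFinrankEq ℤ T.lattice hrank
  let c := b.ofZLatticeBasis ℝ T.lattice
  have hc : Submodule.span ℤ (Set.range c) = T.lattice := b.ofZLatticeBasis_span ℝ
  let B : Matrix (Fin n) (Fin n) ℝ := Matrix.of fun j l => c j l
  have hB : IsUnit B := by
    rw [← Matrix.linearIndependent_rows_iff_isUnit]
    exact c.linearIndependent.map' (WithLp.linearEquiv 2 ℝ (Fin n → ℝ)).toLinearMap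
      (LinearEquiv.ker _)
  refine ⟨B, B⁻¹, Matrix.mul_nonsing_inv B ((Matrix.isUnit_iff_isUnit_det B).1 hB), fun y => ?_⟩
  rw [← hc, Submodule.mem_span_range_iff_exists_fun]
  refine exists_congr fun m => ⟨?_, fun h => ?_⟩
  · rintro rfl l
    simp [B]
  · ext l
    rw [h]
    simp [B]

/-! ### The collapsing family over a flat torus -/

namespace CollapsingFamily

open Matrix

variable {d r : ℕ}

/-- The real parts of the first `d` coordinates. -/
def proj (d r : ℕ) : EuclideanSpace ℂ (Fin d ⊕ Fin r) →ₗ[ℝ] EuclideanSpace ℝ (Fin d) where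
  toFun x := WithLp.toLp 2 fun l => (x (Sum.inl l)).re
  map_add' x y := by
    ext l
    simp
  map_smul' c x := by
    ext l
    simp

theorem proj_apply (x : EuclideanSpace ℂ (Fin d ⊕ Fin r)) (l : Fin d) :
    proj d r x l = (x (Sum.inl l)).re := rfl

theorem norm_proj_le (x : EuclideanSpace ℂ (Fin d ⊕ Fin r)) : ‖proj d r x‖ ≤ ‖x‖ := by
  rw [EuclideanSpace.norm_eq, EuclideanSpace.norm_eq]
  refine Real.sqrt_le_sqrt ?_
  rw [Fintype.sum_sum_type]
  refine le_add_of_le_of_nonneg (Finset.sum_le_sum fun l _ => ?_)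
    (Finset.sum_nonneg fun l _ => sq_nonneg _)
  exact pow_le_pow_left₀ (norm_nonneg _) (Complex.abs_re_le_norm _) 2

theorem exists_proj_eq (y : EuclideanSpace ℝ (Fin d)) :
    ∃ x : EuclideanSpace ℂ (Fin d ⊕ Fin r), proj d r x = y ∧ ‖x‖ ≤ ‖y‖ ∧
      (∀ l, x (Sum.inl l) = y l) ∧ ∀ l, x (Sum.inr l) = 0 := by
  refine ⟨WithLp.toLp 2 (Sum.elim (fun l => (y l : ℂ)) 0), ?_, ?_, fun l => rfl, fun l => rfl⟩
  · ext l
    simp [proj_apply]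
  · rw [EuclideanSpace.norm_eq, EuclideanSpace.norm_eq, Fintype.sum_sum_type]
    simp

/-- Separates the part seen by `T` from the coordinates that collapse. -/
theorem norm_le (x : EuclideanSpace ℂ (Fin d ⊕ Fin r)) :
    ‖x‖ ≤ ‖proj d r x‖ + (∑ l, |(x (Sum.inr l)).re| + ∑ l, |(x l).im|) := by
  obtain ⟨y, -, hy, hyl, hyr⟩ := exists_proj_eq (r := r) (proj d r x)
  have hx : x = y + (∑ l, EuclideanSpace.single (Sum.inr l) ((x (Sum.inr l)).re : ℂ) +
      ∑ l, EuclideanSpace.single l ((x l).im * Complex.I)) := by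
    ext l
    simp only [PiLp.add_apply, WithLp.ofLp_sum, Finset.sum_apply]
    rcases l with l | l
    · rw [hyl]
      apply Complex.ext <;> simp [proj_apply]
    · rw [hyr]
      apply Complex.ext <;> simp
  calc ‖x‖ ≤ ‖y‖ + (‖∑ l, EuclideanSpace.single (Sum.inr l) ((x (Sum.inr l)).re : ℂ)‖ +
        ‖∑ l, EuclideanSpace.single l ((x l).im * Complex.I)‖) := by
        conv_lhs => rw [hx]
        exact (norm_add_le _ _).trans (add_le_add_right (norm_add_le _ _) _)
    _ ≤ _ := by
        refine add_le_add hy (add_le_add (norm_sum_le_of_le _ fun l _ => ?_)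
          (norm_sum_le_of_le _ fun l _ => ?_)) <;> simp

/-- The rows of this matrix are the real generators of the collapsing lattice. -/
def realBasis (r : ℕ) (B : Matrix (Fin d) (Fin d) ℝ) (s : ℝ) :
    Matrix (Fin d ⊕ Fin r) (Fin d ⊕ Fin r) ℝ :=
  fromBlocks (s ^ 2 • B) 0 0 (s • 1)

/-- The columns of this matrix are the imaginary generators of the collapsing lattice. -/
noncomputable def dualBasis (r : ℕ) (C : Matrix (Fin d) (Fin d) ℝ) (s : ℝ) :
    Matrix (Fin d ⊕ Fin r) (Fin d ⊕ Fin r) ℝ :=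
  fromBlocks ((s ^ 2)⁻¹ • C) 0 0 (s⁻¹ • 1)

theorem realBasis_mul_dualBasis {B C : Matrix (Fin d) (Fin d) ℝ} (hBC : B * C = 1) {s : ℝ}
    (hs : s ≠ 0) : realBasis r B s * dualBasis r C s = 1 := by
  rw [realBasis, dualBasis, fromBlocks_multiply]
  simp [hBC, smul_smul, hs]

/-- Uniform decay of the imaginary generators, with their values at `s = 1` as constants. It gives
both the collapse and the growth of `Im Z`. -/
theorem abs_dualBasis_le (C : Matrix (Fin d) (Fin d) ℝ) {s : ℝ} (hs : 1 ≤ s)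
    (i j : Fin d ⊕ Fin r) : |dualBasis r C s i j| ≤ s⁻¹ * |dualBasis r C 1 i j| := by
  have h0 : 0 < s := by linarith
  have h1 : (s ^ 2)⁻¹ ≤ s⁻¹ := inv_anti₀ h0 (by nlinarith)
  rcases i with i | i <;> rcases j with j | j <;>
    simp only [dualBasis, fromBlocks_apply₁₁, fromBlocks_apply₁₂, fromBlocks_apply₂₁,
      fromBlocks_apply₂₂, Matrix.smul_apply, Matrix.zero_apply, smul_eq_mul, abs_mul, abs_zero,
      mul_zero, le_refl, one_pow, inv_one, one_mul]
  · rw [abs_of_pos (by positivity)]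
    exact mul_le_mul_of_nonneg_right h1 (abs_nonneg _)
  · rw [abs_of_pos (by positivity)]

/-- The distance to the collapsing lattice, up to an error linear in `s`. -/
theorem abs_infDist_sub_le (T : FlatTorus d) {B C : Matrix (Fin d) (Fin d) ℝ} (hBC : B * C = 1)
    (hT : ∀ y, y ∈ T.lattice ↔ ∃ m : Fin d → ℤ, ∀ l, y l = ∑ j, m j * B j l) {s : ℝ}
    (hs : 1 ≤ s) {Λ : Set (EuclideanSpace ℂ (Fin d ⊕ Fin r))}
    (hΛ : ∀ x, x ∈ Λ ↔ ∃ m n : Fin d ⊕ Fin r → ℤ, ∀ l,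
      (x l).re = ∑ j, m j * realBasis r B s j l ∧ (x l).im = ∑ j, n j * dualBasis r C s l j)
    (x : EuclideanSpace ℂ (Fin d ⊕ Fin r)) :
    |Metric.infDist (((s ^ 2 : ℝ) : ℂ) • x) Λ -
      s ^ 2 * Metric.infDist (proj d r x) (T.lattice : Set _)| ≤
        (r + ∑ i, ∑ j, |dualBasis r C 1 i j|) * s := by
  have hs0 : 0 < s := by linarith
  have hs2 : 0 < s ^ 2 := by positivity
  set κ := ∑ i, ∑ j, |dualBasis r C 1 i j| with hκ
  have hκ0 : 0 ≤ κ := Finset.sum_nonneg fun i _ => Finset.sum_nonneg fun j _ => abs_nonneg _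
  have hδ : 0 ≤ (r + κ) * s := by positivity
  have hΛ0 : (0 : EuclideanSpace ℂ (Fin d ⊕ Fin r)) ∈ Λ := (hΛ 0).2 ⟨0, 0, by simp⟩
  have hsmul : proj d r (((s ^ 2 : ℝ) : ℂ) • x) = s ^ 2 • proj d r x := by
    rw [Complex.coe_smul, map_smul]
  rw [abs_le]
  constructor
  -- The lower bound needs no error term: `proj` is a contraction and maps `Λ` into `s²` times the
  -- lattice of `T`.
  · rw [neg_le_sub_iff_le_add, ← sub_le_iff_le_add]
    refine (Metric.le_infDist ⟨0, hΛ0⟩).2 fun z hz => ?_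
    obtain ⟨m, n, hmn⟩ := (hΛ z).1 hz
    have hmem : (s ^ 2)⁻¹ • proj d r z ∈ T.lattice := by
      refine (hT _).2 ⟨fun j => m (Sum.inl j), fun l => ?_⟩
      rw [PiLp.smul_apply, proj_apply, (hmn _).1, Fintype.sum_sum_type]
      simp only [realBasis, fromBlocks_apply₁₁, fromBlocks_apply₂₁, Matrix.smul_apply,
        Matrix.zero_apply, mul_zero, Finset.sum_const_zero, add_zero, smul_eq_mul, Finset.mul_sum]
      refine Finset.sum_congr rfl fun j _ => ?_
      field_simp
    have h1 := Metric.infDist_le_dist_of_mem (x := proj d r x) hmem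
    have h2 : s ^ 2 * dist (proj d r x) ((s ^ 2)⁻¹ • proj d r z) ≤
        dist (((s ^ 2 : ℝ) : ℂ) • x) z := by
      rw [dist_eq_norm, dist_eq_norm]
      refine le_trans (le_of_eq ?_) (norm_proj_le _)
      rw [map_sub, hsmul, ← abs_of_pos hs2, ← Real.norm_eq_abs, ← norm_smul, Real.norm_eq_abs,
        abs_of_pos hs2, smul_sub, smul_inv_smul₀ hs2.ne']
    nlinarith
  · rw [sub_le_iff_le_add, ← sub_le_iff_le_add', ← div_le_iff₀' hs2]
    refine (Metric.le_infDist ⟨0, T.lattice.zero_mem⟩).2 fun t ht => ?_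
    rw [div_le_iff₀' hs2, sub_le_iff_le_add']
    obtain ⟨m, hm⟩ := (hT t).1 ht
    set y := ((s ^ 2 : ℝ) : ℂ) • x with hy
    -- A lift of `t` to `Λ` close to `y`: the collapsing real coordinates are rounded on the grid of
    -- mesh `s`, and `q`, the coordinates of `Im y` in the columns of `dualBasis`, are rounded to
    -- integers.
    let m' : Fin d ⊕ Fin r → ℤ := Sum.elim m fun l => ⌊(y (Sum.inr l)).re / s⌋
    let q : Fin d ⊕ Fin r → ℝ := realBasis r B s *ᵥ fun l => (y l).im
    let z : EuclideanSpace ℂ (Fin d ⊕ Fin r) := WithLp.toLp 2 fun l =>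
      (⟨∑ j, m' j * realBasis r B s j l, ∑ j, (⌊q j⌋ : ℝ) * dualBasis r C s l j⟩ : ℂ)
    have hz : z ∈ Λ := (hΛ z).2 ⟨m', fun j => ⌊q j⌋, fun l => ⟨rfl, rfl⟩⟩
    refine (Metric.infDist_le_dist_of_mem hz).trans ?_
    rw [dist_eq_norm]
    refine (norm_le _).trans ?_
    have hproj : ‖proj d r (y - z)‖ = s ^ 2 * dist (proj d r x) t := by
      have hzt : proj d r z = s ^ 2 • t := by
        ext l
        rw [PiLp.smul_apply, proj_apply, hm]
        simp only [z, Fintype.sum_sum_type, m', realBasis, fromBlocks_apply₁₁,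
          fromBlocks_apply₂₁, Matrix.smul_apply, Matrix.zero_apply, mul_zero,
          Finset.sum_const_zero, add_zero, smul_eq_mul, Finset.mul_sum, Sum.elim_inl]
        exact Finset.sum_congr rfl fun j _ => by ring
      rw [map_sub, hsmul, hzt, ← smul_sub, norm_smul, Real.norm_of_nonneg hs2.le, dist_eq_norm]
    have hre : ∑ l : Fin r, |((y - z) (Sum.inr l)).re| ≤ r * s := by
      refine (Finset.sum_le_card_nsmul _ _ s fun l _ => ?_).trans_eq (by simp)
      have h1 : (z (Sum.inr l)).re = ⌊(y (Sum.inr l)).re / s⌋ * s := by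
        simp [z, Fintype.sum_sum_type, m', realBasis, Matrix.one_apply]
      have h2 : ((y - z) (Sum.inr l)).re = Int.fract ((y (Sum.inr l)).re / s) * s := by
        rw [PiLp.sub_apply, Complex.sub_re, h1, Int.fract, sub_mul, div_mul_cancel₀ _ hs0.ne']
      rw [h2, abs_of_nonneg (mul_nonneg (Int.fract_nonneg _) hs0.le)]
      exact mul_le_of_le_one_left hs0.le (Int.fract_lt_one _).le
    have him : ∑ l, |((y - z) l).im| ≤ κ * s := by
      have h0 : κ ≤ κ * s := le_mul_of_one_le_right hκ0 hs
      refine le_trans (Finset.sum_le_sum fun l _ => ?_) h0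
      have h1 : (y l).im = ∑ j, q j * dualBasis r C s l j := by
        have h2 : dualBasis r C s *ᵥ q = fun l => (y l).im := by
          rw [mulVec_mulVec, mul_eq_one_comm.1 (realBasis_mul_dualBasis hBC hs0.ne'), one_mulVec]
        rw [← congrFun h2 l]
        simp only [mulVec, dotProduct, mul_comm]
      have h3 : ((y - z) l).im = ∑ j, Int.fract (q j) * dualBasis r C s l j := by
        rw [PiLp.sub_apply, Complex.sub_im, h1]
        simp only [z, ← Finset.sum_sub_distrib, ← sub_mul, Int.self_sub_floor]
      rw [h3]
      refine (Finset.abs_sum_le_sum_abs _ _).trans (Finset.sum_le_sum fun j _ => ?_)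
      rw [abs_mul, Int.abs_fract]
      refine (mul_le_of_le_one_left (abs_nonneg _) (Int.fract_lt_one _).le).trans
        ((abs_dualBasis_le C hs l j).trans ?_)
      exact mul_le_of_le_one_left (abs_nonneg _) (inv_le_one_of_one_le₀ hs)
    rw [hproj]
    linarith

end CollapsingFamily

open CollapsingFamily in
/-- Every flat torus of dimension `d ≤ g` and diameter `1` is a limit of normalized principally
polarized abelian varieties whose moduli points tend to the cusp. -/
theorem FlatTorus.exists_tendsto {g d r : ℕ} (hdr : d + r = g) (T : FlatTorus d)
    (hT : T.diam = 1) : ∃ V : ℕ → PPAV g, ConvergesToCusp V ∧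
      Tendsto (fun i => (V i).toNormalizedGH) atTop (𝓝 T.toGH) := by
  obtain ⟨B, C, hBC, hlat⟩ := T.exists_matrix
  let e : Fin g ≃ Fin d ⊕ Fin r := (finCongr hdr.symm).trans finSumFinEquiv.symm
  let s : ℕ → ℝ := fun i => i + 1
  have hs : ∀ i, 1 ≤ s i := fun i => le_add_of_nonneg_left (Nat.cast_nonneg i)
  have hs0 : ∀ i, 0 < s i := fun i => by linarith [hs i]
  have hslim : Tendsto s atTop atTop :=
    tendsto_atTop_add_const_right _ _ tendsto_natCast_atTop_atTop
  have hmul : ∀ i, realBasis r B (s i) * dualBasis r C (s i) = 1 := fun i =>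
    realBasis_mul_dualBasis hBC (hs0 i).ne'
  choose V u hu Z hZ hper using fun i => PPAV.exists_of_matrix e (hmul i)
  refine ⟨V, ⟨Z, hper, SatakeBB.tendsto_cusp Z fun c hc => ?_⟩, ?_⟩
  -- The inverse of `realBasis` has squared Frobenius norm at most `κ / s²`, so `B Bᵀ` eventually
  -- exceeds `c`.
  · set κ := ∑ i, ∑ j, dualBasis r C 1 i j ^ 2 with hκ
    have hlim : Tendsto (fun i => c * ((s i)⁻¹ ^ 2 * κ)) atTop (𝓝 (c * (0 ^ 2 * κ))) :=
      (((tendsto_inv_atTop_zero.comp hslim).pow 2).mul_const κ).const_mul c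
    have hlt : c * (0 ^ 2 * κ) < 1 := by simp
    filter_upwards [hlim.eventually_lt_const hlt] with i hi
    have hle : ∑ a, ∑ b, dualBasis r C (s i) a b ^ 2 ≤ (s i)⁻¹ ^ 2 * κ := by
      rw [hκ, Finset.mul_sum]
      refine Finset.sum_le_sum fun a _ => ?_
      rw [Finset.mul_sum]
      refine Finset.sum_le_sum fun b _ => ?_
      rw [← sq_abs, ← sq_abs (dualBasis r C 1 a b), ← mul_pow]
      exact pow_le_pow_left₀ (abs_nonneg _) (abs_dualBasis_le C (hs i) a b) 2
    have hpos := Matrix.posDef_mul_transpose_sub (hmul i) hc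
      (lt_of_le_of_lt (mul_le_mul_of_nonneg_left hle hc.le) hi)
    have heq : (Z i).1.map Complex.im - c • (1 : Matrix (Fin g) (Fin g) ℝ) =
        (realBasis r B (s i) * (realBasis r B (s i)).transpose -
          c • (1 : Matrix (Fin d ⊕ Fin r) (Fin d ⊕ Fin r) ℝ)).submatrix e e := by
      rw [hZ]
      ext a b
      simp [Matrix.one_apply]
    rw [heq]
    exact hpos.submatrix e.injective
  -- Scale `s²` against an error linear in `s`: the ratio is of order `1 / s`.
  · refine PPAV.tendsto_toNormalizedGH V u T hT (proj d r)
      (fun y => (exists_proj_eq y).imp fun x hx => ⟨hx.1, hx.2.1⟩) (fun i => s i ^ 2)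
      (fun i => (r + ∑ a, ∑ b, |dualBasis r C 1 a b|) * s i) (fun i => pow_pos (hs0 i) 2) ?_
      fun i x => ?_
    · have h : Tendsto (fun i => (r + ∑ a, ∑ b, |dualBasis r C 1 a b|) / s i) atTop (𝓝 0) :=
        tendsto_const_nhds.div_atTop hslim
      refine h.congr fun i => ?_
      have := (hs0 i).ne'
      field_simp
    · rw [Submodule.Quotient.norm_mk_eq_infDist, Submodule.Quotient.norm_mk_eq_infDist]
      have himg : ((V i).lattice : Set (V i).carrier) = u i '' {y | u i y ∈ (V i).lattice} := by
        ext y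
        refine ⟨fun hy => ⟨(u i).symm y, ?_, (u i).apply_symm_apply y⟩, ?_⟩
        · change u i ((u i).symm y) ∈ (V i).lattice
          rwa [(u i).apply_symm_apply]
        · rintro ⟨x, hx, rfl⟩
          exact hx
      rw [himg, Metric.infDist_image (u i).isometry]
      exact abs_infDist_sub_le T hBC hlat (hs i) (fun x => hu i x) x

theorem theorem2p1 (g : ℕ) (hg : 0 < g) :
    (∀ V : ℕ → PPAV g, ConvergesToCusp V →
      ∃ φ : ℕ → ℕ, StrictMono φ ∧ ∃ r : ℕ, r < g ∧ ∃ T : FlatTorus (g - r), T.diam = 1 ∧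
        Tendsto (fun i => (V (φ i)).toNormalizedGH) atTop (𝓝 T.toGH)) ∧
    (∀ r : ℕ, r < g → ∀ T : FlatTorus (g - r), T.diam = 1 →
      ∃ V : ℕ → PPAV g, ConvergesToCusp V ∧
        Tendsto (fun i => (V i).toNormalizedGH) atTop (𝓝 T.toGH)) := by
  refine ⟨fun V hV => PPAV.exists_subseq_tendsto_flatTorus hg V fun ε hε =>
    hV.eventually_short hε, fun r hr T hT =>
    T.exists_tendsto (Nat.sub_add_cancel hr.le) hT⟩
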